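/- Let $F$ be a germ at $0$ of a holomorphic diffeomorphism of $\mathbb{C}^n$ with $F(0)=0$ and diagonal differential $dF_0=\mathrm{diag}(\lambda_1,\ldots,\lambda_n)$. A resonance is a pair $(j,l)$ with $1\le j\le n$, $l\in\mathbb{N}^n$, $|l|\ge 2$ and $\lambda_j=\lambda^l:=\lambda_1^{l_1}\cdots\lambda_n^{l_n}$; the corresponding monomial $z^l$ in the $j$-th component of a formal map is called resonant. Let $1\le m\le n$ and suppose that $F$ is one-resonant with respect to $\lambda_1,\ldots,\lambda_m$ with index of resonance $\alpha$: that is, $\alpha=(\alpha_1,\ldots,\alpha_m,0,\ldots,0)\in\mathbb{N}^n$, $\alpha\neq 0$, and the resonances $(j,l)$ with $j\le m$ are precisely the pairs $(j,k\alpha+e_j)$ with $1\le j\le m$ and $k\ge 1$ an integer, $e_j$ being the $j$-th unit vector. Suppose moreover that $F$ is non-degenerate with respect to $\lambda_1,\ldots,\lambda_m$: that is, $F$ is formally conjugate to a formal map $G$ with $G(0)=0$ and linear part $\mathrm{diag}(\lambda_1,\ldots,\lambda_n)$ (possibly $G=F$) such that $$G_j(z)=\lambda_jz_j+c_jz^{r\alpha}z_j+O(|z|^{r|\alpha|+2}),\qquad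 j=1,\ldots,m,$$ for some integer $r\ge1$ and some $c=(c_1,\ldots,c_m)\in\mathbb{C}^m\setminus\{0\}$ with $\sum_{j=1}^m c_j\alpha_j/\lambda_j\neq0$. (Two formal maps $A,B$ without constant term are formally conjugate if $\Phi\circ A=B\circ\Phi$ for a formal map $\Phi$ without constant term and with invertible linear part; a germ is identified with its Taylor series.) Then there exist an integer $k\ge 1$ and numbers $\mu,a_1,\ldots,a_m\in\mathbb{C}$ such that $F$ is formally conjugate to a formal map $\hat F=(\hat F_1,\ldots,\hat F_n)$ with $$\hat F_j(z)=\lambda_jz_j+a_jz^{k\alpha}z_j+\mu\,\alpha_j\,\overline{\lambda_j}^{\,-1}z^{2k\alpha}z_j,\qquad j=1,\ldots,m,$$ and such that for $j=m+1,\ldots,n$ the component $\hat F_j$ is the sum of $\lambda_jz_j$ and of a (possibly infinite) formal sum of resonant monomials, with coefficients. -/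

import Mathlib

open MvPowerSeries Topology
open scoped ComplexConjugate

namespace OneResonant

/-- `F` represents a germ of holomorphic diffeomorphism of `ℂⁿ` fixing the origin:
it is holomorphic near `0`, fixes `0`, and has a holomorphic inverse germ at `0`. -/
def IsDiffGerm {n : ℕ} (F : (Fin n → ℂ) → (Fin n → ℂ)) : Prop :=
  AnalyticAt ℂ F 0 ∧ F 0 = 0 ∧
    ∃ G : (Fin n → ℂ) → (Fin n → ℂ), AnalyticAt ℂ G 0 ∧ G 0 = 0 ∧
      (∀ᶠ z in 𝓝 (0 : Fin n → ℂ), G (F z) = z) ∧ (∀ᶠ z in 𝓝 (0 : Fin n → ℂ), F (G z) = z)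

/-- The differential of `F` at `0` is the diagonal map `diag(lam)`. -/
def HasDiagonalDifferential {n : ℕ} (F : (Fin n → ℂ) → (Fin n → ℂ)) (lam : Fin n → ℂ) : Prop :=
  ∀ v j, fderiv ℂ F 0 v j = lam j * v j

/-- `(j, l)` is a resonance of `lam`: `|l| ≥ 2` and `lam_j = lam ^ l`. -/
def IsResonance {n : ℕ} (lam : Fin n → ℂ) (j : Fin n) (l : Fin n →₀ ℕ) : Prop :=
  2 ≤ l.degree ∧ lam j = ∏ i, lam i ^ l i

/-- A germ with eigenvalues `lam` is one-resonant with respect to the first `m` of them, with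
index of resonance `α`. -/
def IsOneResonant {n : ℕ} (lam : Fin n → ℂ) (m : ℕ) (α : Fin n →₀ ℕ) : Prop :=
  α ≠ 0 ∧ (∀ i : Fin n, m ≤ (i : ℕ) → α i = 0) ∧
    ∀ j : Fin n, (j : ℕ) < m → ∀ l : Fin n →₀ ℕ,
      IsResonance lam j l ↔ ∃ k : ℕ, 1 ≤ k ∧ l = k • α + Finsupp.single j 1

/-- Formal maps: `n`-tuples of formal power series in `n` variables. -/
abbrev FormalMap (n : ℕ) : Type := Fin n → MvPowerSeries (Fin n) ℂ

/-- The partial derivative `∂f/∂z_i`. -/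
noncomputable def partialDeriv {n : ℕ} (i : Fin n) (f : (Fin n → ℂ) → ℂ) : (Fin n → ℂ) → ℂ :=
  fun z => fderiv ℂ f z (Pi.single i 1)

/-- `∂^l f = ∂_1^{l_1} ⋯ ∂_n^{l_n} f`. -/
noncomputable def iteratedPartialDeriv {n : ℕ} (l : Fin n →₀ ℕ) (f : (Fin n → ℂ) → ℂ) :
    (Fin n → ℂ) → ℂ :=
  (List.finRange n).foldr (fun i g => (partialDeriv i)^[l i] g) f

/-- The Taylor expansion of `F` at `0`. -/
noncomputable def taylor {n : ℕ} (F : (Fin n → ℂ) → (Fin n → ℂ)) : FormalMap n :=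
  fun j l => iteratedPartialDeriv l (fun z => F z j) 0 / ∏ i, ((l i).factorial : ℂ)

/-- Composition `A ∘ B` of formal maps (meaningful when `B` has no constant term). -/
noncomputable def FormalMap.comp {n : ℕ} (A B : FormalMap n) : FormalMap n :=
  fun j => (A j).subst B

/-- The matrix of the linear part of a formal map. -/
noncomputable def FormalMap.linearPart {n : ℕ} (A : FormalMap n) : Matrix (Fin n) (Fin n) ℂ :=
  Matrix.of fun j i => coeff (Finsupp.single i 1) (A j)

/-- Formal diffeomorphisms of `(ℂⁿ, 0)`: no constant term and invertible linear part. -/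
def FormalMap.IsFormalDiffeo {n : ℕ} (A : FormalMap n) : Prop :=
  (∀ j, constantCoeff (A j) = 0) ∧ IsUnit A.linearPart

/-- `A` and `B` are conjugate by a formal diffeomorphism `Φ`: `Φ ∘ A = B ∘ Φ`,
i.e. `B = Φ ∘ A ∘ Φ⁻¹`. -/
def FormallyConjugate {n : ℕ} (A B : FormalMap n) : Prop :=
  ∃ Φ : FormalMap n, Φ.IsFormalDiffeo ∧ Φ.comp A = B.comp Φ

/-- `G` has no constant term, linear part `diag(lam)`, and
`G_j(z) = lam_j z_j + a_j z^{kα} z_j + O(|z|^{k|α|+2})` for `j = 1, …, m`. -/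
def HasLeadingForm {n m : ℕ} (hmn : m ≤ n) (lam : Fin n → ℂ) (α : Fin n →₀ ℕ)
    (k : ℕ) (a : Fin m → ℂ) (G : FormalMap n) : Prop :=
  (∀ j, constantCoeff (G j) = 0) ∧ G.linearPart = Matrix.diagonal lam ∧
    ∀ j : Fin m, ∀ l : Fin n →₀ ℕ, l.degree < k * α.degree + 2 →
      coeff l (G (Fin.castLE hmn j)) =
        coeff l (C (lam (Fin.castLE hmn j)) * X (Fin.castLE hmn j)
          + C (a j) * monomial (k • α) 1 * X (Fin.castLE hmn j) : MvPowerSeries (Fin n) ℂ)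

/-- Non-degeneracy with respect to the first `m` eigenvalues, for index of resonance `α`:
the germ is, up to formal conjugation, of the form
`lam_j z_j + a_j z^{kα} z_j + O(|z|^{k|α|+2})`, `j = 1, …, m`, with `k ≥ 1`, `a ≠ 0` and
`Λ = ∑_{j ≤ m} a_j α_j / lam_j ≠ 0`. -/
def IsNonDegenerate {n m : ℕ} (hmn : m ≤ n) (F : (Fin n → ℂ) → (Fin n → ℂ)) (lam : Fin n → ℂ)
    (α : Fin n →₀ ℕ) : Prop :=
  ∃ (G : FormalMap n) (k : ℕ) (a : Fin m → ℂ),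
    FormallyConjugate (taylor F) G ∧ 1 ≤ k ∧ a ≠ 0 ∧ HasLeadingForm hmn lam α k a G ∧
      ∑ j : Fin m, a j * (α (Fin.castLE hmn j) : ℂ) / lam (Fin.castLE hmn j) ≠ 0

/-- The `j`-th component of `G` is `lam_j z_j` plus (possibly infinitely many) resonant
monomials. -/
def HasOnlyResonantMonomials {n : ℕ} (lam : Fin n → ℂ) (G : FormalMap n) (j : Fin n) : Prop :=
  coeff (Finsupp.single j 1) (G j) = lam j ∧
    ∀ l : Fin n →₀ ℕ, coeff l (G j) ≠ 0 → l = Finsupp.single j 1 ∨ IsResonance lam j l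

end OneResonant

/-!
A Poincaré–Dulac conjugation, whose non-linear terms are all non-resonant, preserves the leading
form and leaves only resonant terms. As `lam ^ α = 1`, the monomial `u = z ^ α` is invariant under
`diag(lam)`, and the first `m` components become `lam_j z_j h_j(u)`. It remains to conjugate by a
map `z_j ↦ z_j p_j(u)`, which commutes with `diag(lam)` and hence keeps all terms resonant. The
coefficients of the `p_j` are found degree by degree: changing the degree `d` coefficients by `δ`
changes the equation in degree `d + r` by `d Λ δ_j - r c_j ∑ α_i δ_i`, where `c_j = a_j / lam_j` and
`Λ = ∑ α_i c_i ≠ 0`. Pairing with `α` multiplies `∑ α_i δ_i` by `(d - r) Λ`, so this linear map is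
invertible except for `d = r`, where `μ` makes up for the missing direction provided that
`∑ β_i α_i / lam_i ≠ 0`; for `β_i = α_i / conj lam_i` this sum is `∑ α_i ^ 2 / |lam_i| ^ 2 > 0`.
-/

namespace OneResonant

section OrderIdeal

variable {σ τ R : Type*} [CommRing R]

/-- The ideal of power series of order at least `d`, that is, of the series which are
`O(|z|^d)`. -/
def orderIdeal (σ R : Type*) [CommRing R] (d : ℕ) : Ideal (MvPowerSeries σ R) where
  carrier := {f | (d : ℕ∞) ≤ f.order}
  zero_mem' := by simp
  add_mem' hf hg := (le_min hf hg).trans min_order_le_add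
  smul_mem' c _ hf := (le_add_of_nonneg_of_le zero_le hf).trans (le_order_mul (f := c))

theorem mem_orderIdeal {d : ℕ} {f : MvPowerSeries σ R} :
    f ∈ orderIdeal σ R d ↔ ∀ l : σ →₀ ℕ, l.degree < d → coeff l f = 0 :=
  ⟨fun hf _ hl => coeff_of_lt_order ((Nat.cast_lt.2 hl).trans_le hf), nat_le_order⟩

theorem orderIdeal_anti : Antitone (orderIdeal σ R) :=
  fun _ _ h _ hf => mem_orderIdeal.2 fun l hl => mem_orderIdeal.1 hf l (hl.trans_le h)

theorem mem_orderIdeal_zero (f : MvPowerSeries σ R) : f ∈ orderIdeal σ R 0 :=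
  mem_orderIdeal.2 fun _ hl => absurd hl (Nat.not_lt_zero _)

theorem mem_orderIdeal_one {f : MvPowerSeries σ R} :
    f ∈ orderIdeal σ R 1 ↔ constantCoeff f = 0 := by
  rw [← one_le_order_iff_constCoeff_eq_zero, ← Nat.cast_one]
  rfl

theorem eq_zero_of_forall_mem_orderIdeal {f : MvPowerSeries σ R} (d₀ : ℕ)
    (h : ∀ d ≥ d₀, f ∈ orderIdeal σ R d) : f = 0 := by
  ext l
  exact mem_orderIdeal.1 (h (d₀ + l.degree + 1) (by omega)) l (by omega)

theorem mul_mem_orderIdeal {d e : ℕ} {f g : MvPowerSeries σ R} (hf : f ∈ orderIdeal σ R d)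
    (hg : g ∈ orderIdeal σ R e) : f * g ∈ orderIdeal σ R (d + e) := by
  change ((d + e : ℕ) : ℕ∞) ≤ (f * g).order
  have h : (d : ℕ∞) + e ≤ f.order + g.order := add_le_add hf hg
  exact_mod_cast h.trans le_order_mul

theorem pow_mem_orderIdeal {f : MvPowerSeries σ R} (hf : f ∈ orderIdeal σ R 1) (t : ℕ) :
    f ^ t ∈ orderIdeal σ R t := by
  induction t with
  | zero => exact mem_orderIdeal_zero _
  | succ t ih => exact pow_succ f t ▸ mul_mem_orderIdeal ih hf

theorem monomial_mem_orderIdeal (l : σ →₀ ℕ) (c : R) :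
    monomial l c ∈ orderIdeal σ R l.degree := by
  classical
  refine mem_orderIdeal.2 fun k hk => ?_
  rw [coeff_monomial, if_neg]
  rintro rfl
  exact lt_irrefl _ hk

theorem X_mem_orderIdeal (s : σ) : (X s : MvPowerSeries σ R) ∈ orderIdeal σ R 1 :=
  mem_orderIdeal_one.2 (constantCoeff_X s)

theorem X_pow_dvd_iff_mem_orderIdeal {d : ℕ} {f : PowerSeries R} :
    PowerSeries.X ^ d ∣ f ↔ f ∈ orderIdeal Unit R d := by
  rw [PowerSeries.X_pow_dvd_iff, mem_orderIdeal]
  refine ⟨fun h l hl => ?_, fun h k hk => h (Finsupp.single () k) (by simpa using hk)⟩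
  rw [Finsupp.unique_single l] at hl ⊢
  exact h _ (by simpa using hl)

theorem exists_forall_of_approx {ι : Type*} (d₀ : ℕ) (P : ℕ → (ι → MvPowerSeries σ R) → Prop)
    (hcongr : ∀ d ≥ d₀, ∀ x y, P d x → (∀ i, y i - x i ∈ orderIdeal σ R d) → P d y)
    (hstep : ∀ d ≥ d₀, ∀ x, P d x → ∃ y, (∀ i, y i - x i ∈ orderIdeal σ R d) ∧ P (d + 1) y)
    {x₀ : ι → MvPowerSeries σ R} (h₀ : P d₀ x₀) : ∃ x, ∀ d ≥ d₀, P d x := by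
  choose! next hclose hnext using hstep
  let s (d : ℕ) : ι → MvPowerSeries σ R := d.rec x₀ fun k x => next (d₀ + k) x
  have hs (d : ℕ) : P (d₀ + d) (s d) := by
    induction d with
    | zero => exact h₀
    | succ d ih => exact hnext _ (Nat.le_add_right _ _) _ ih
  have hcauchy {d e : ℕ} (hde : d ≤ e) (i : ι) : s e i - s d i ∈ orderIdeal σ R (d₀ + d) := by
    induction e, hde using Nat.le_induction with
    | base => simp
    | succ e hde ih =>
      have h := orderIdeal_anti (Nat.add_le_add_left hde d₀)
        (hclose _ (Nat.le_add_right d₀ e) _ (hs e) i)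
      simpa using add_mem h ih
  let x (i : ι) : MvPowerSeries σ R := fun l => coeff l (s (l.degree + 1) i)
  have hlimit (d : ℕ) (i : ι) : x i - s d i ∈ orderIdeal σ R (d₀ + d) := by
    refine mem_orderIdeal.2 fun l hl => ?_
    rw [map_sub, sub_eq_zero]
    rcases le_total d (l.degree + 1) with h | h
    · exact sub_eq_zero.1 (map_sub (coeff (R := R) l) _ _ ▸ mem_orderIdeal.1 (hcauchy h i) l hl)
    · exact (sub_eq_zero.1 (map_sub (coeff (R := R) l) _ _ ▸
        mem_orderIdeal.1 (hcauchy h i) l (by omega))).symm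
  refine ⟨x, fun d hd => ?_⟩
  obtain ⟨k, rfl⟩ := Nat.exists_eq_add_of_le hd
  exact hcongr _ hd _ _ (hs k) (hlimit k)

section Subst

variable {a b : σ → MvPowerSeries τ R}

theorem prod_pow_mem_orderIdeal (ha : ∀ s, a s ∈ orderIdeal τ R 1) (k : σ →₀ ℕ) :
    (k.prod fun s e => a s ^ e) ∈ orderIdeal τ R k.degree := by
  classical
  induction k using Finsupp.induction_linear with
  | zero => exact mem_orderIdeal_zero _
  | add f g hf hg =>
    rw [Finsupp.prod_add_index' (fun _ => pow_zero _) (fun _ _ _ => pow_add _ _ _), map_add]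
    exact mul_mem_orderIdeal hf hg
  | single s t =>
    simp only [Finsupp.prod_single_index, pow_zero, Finsupp.degree_single]
    exact pow_mem_orderIdeal (ha s) t

theorem pow_sub_pow_mem_orderIdeal {f g : MvPowerSeries σ R} {d : ℕ}
    (hf : f ∈ orderIdeal σ R 1) (hg : g ∈ orderIdeal σ R 1) (hfg : f - g ∈ orderIdeal σ R (d + 1))
    (t : ℕ) : f ^ t - g ^ t ∈ orderIdeal σ R (d + t) := by
  induction t with
  | zero => simp
  | succ t ih =>
    have h : f ^ (t + 1) - g ^ (t + 1) = (f - g) * f ^ t + (f ^ t - g ^ t) * g := by ring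
    rw [h]
    exact add_mem
      (orderIdeal_anti (by omega) (mul_mem_orderIdeal hfg (pow_mem_orderIdeal hf t)))
      (orderIdeal_anti (by omega) (mul_mem_orderIdeal ih hg))

theorem prod_pow_sub_prod_pow_mem_orderIdeal {d : ℕ} (ha : ∀ s, a s ∈ orderIdeal τ R 1)
    (hb : ∀ s, b s ∈ orderIdeal τ R 1) (hab : ∀ s, a s - b s ∈ orderIdeal τ R (d + 1))
    (k : σ →₀ ℕ) :
    (k.prod fun s e => a s ^ e) - (k.prod fun s e => b s ^ e) ∈ orderIdeal τ R (d + k.degree) := by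
  classical
  induction k using Finsupp.induction_linear with
  | zero => simp
  | add f g hf hg =>
    simp only [Finsupp.prod_add_index' (fun _ => pow_zero _) (fun _ _ _ => pow_add _ _ _), map_add]
    have h (A A' B B' : MvPowerSeries τ R) : A * A' - B * B' = A * (A' - B') + (A - B) * B' := by
      ring
    rw [h]
    exact add_mem
      (orderIdeal_anti (by omega) (mul_mem_orderIdeal (prod_pow_mem_orderIdeal ha f) hg))
      (orderIdeal_anti (by omega) (mul_mem_orderIdeal hf (prod_pow_mem_orderIdeal hb g)))
  | single s t =>
    simp only [Finsupp.prod_single_index, pow_zero, Finsupp.degree_single]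
    exact pow_sub_pow_mem_orderIdeal (ha s) (hb s) (hab s) t

variable [Finite σ]

theorem hasSubst_of_mem_orderIdeal (ha : ∀ s, a s ∈ orderIdeal τ R 1) : HasSubst a :=
  hasSubst_of_constantCoeff_zero fun s => mem_orderIdeal_one.1 (ha s)

theorem subst_mem_orderIdeal {d : ℕ} {f : MvPowerSeries σ R}
    (ha : ∀ s, a s ∈ orderIdeal τ R 1) (hf : f ∈ orderIdeal σ R d) :
    f.subst a ∈ orderIdeal τ R d := by
  refine mem_orderIdeal.2 fun l hl => ?_
  rw [coeff_subst (hasSubst_of_mem_orderIdeal ha)]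
  refine finsum_eq_zero_of_forall_eq_zero fun k => ?_
  rcases lt_or_ge k.degree d with hk | hk
  · rw [mem_orderIdeal.1 hf k hk, zero_smul]
  · rw [mem_orderIdeal.1 (prod_pow_mem_orderIdeal ha k) l (hl.trans_le hk), smul_zero]

theorem subst_sub_subst_mem_orderIdeal {d e : ℕ} {f : MvPowerSeries σ R}
    (ha : ∀ s, a s ∈ orderIdeal τ R 1) (hb : ∀ s, b s ∈ orderIdeal τ R 1)
    (hab : ∀ s, a s - b s ∈ orderIdeal τ R (d + 1)) (hf : f ∈ orderIdeal σ R e) :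
    f.subst a - f.subst b ∈ orderIdeal τ R (d + e) := by
  refine mem_orderIdeal.2 fun l hl => ?_
  have ha' := hasSubst_of_mem_orderIdeal ha
  have hb' := hasSubst_of_mem_orderIdeal hb
  rw [map_sub, coeff_subst ha', coeff_subst hb',
    ← finsum_sub_distrib (coeff_subst_finite ha' f l) (coeff_subst_finite hb' f l)]
  refine finsum_eq_zero_of_forall_eq_zero fun k => ?_
  rcases lt_or_ge k.degree e with hk | hk
  · rw [mem_orderIdeal.1 hf k hk, zero_smul, zero_smul, sub_zero]
  · rw [← smul_sub, ← map_sub, mem_orderIdeal.1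
      (prod_pow_sub_prod_pow_mem_orderIdeal ha hb hab k) l (by omega), smul_zero]

end Subst

end OrderIdeal

section LeadingTerm

variable {R : Type*} [CommRing R]

/-- `f = δ T ^ d + O(T ^ (d + 1))`; the coefficient `δ` is allowed to vanish. -/
def HasLeadingTerm (d : ℕ) (δ : R) (f : PowerSeries R) : Prop :=
  ∃ g, PowerSeries.constantCoeff g = δ ∧ f = PowerSeries.X ^ d * g

namespace HasLeadingTerm

variable {d e : ℕ} {δ ε : R} {f g : PowerSeries R}

theorem X_pow_dvd (hf : HasLeadingTerm d δ f) : PowerSeries.X ^ d ∣ f :=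
  let ⟨g, _, hg⟩ := hf
  ⟨g, hg⟩

theorem exists_of_X_pow_dvd (hf : PowerSeries.X ^ d ∣ f) : ∃ δ, HasLeadingTerm d δ f :=
  let ⟨g, hg⟩ := hf
  ⟨_, g, rfl, hg⟩

theorem of_X_pow_succ_dvd (hf : PowerSeries.X ^ (d + 1) ∣ f) : HasLeadingTerm d 0 f := by
  obtain ⟨g, rfl⟩ := hf
  exact ⟨PowerSeries.X * g, by simp, by ring⟩

theorem X_pow_succ_dvd (hf : HasLeadingTerm d 0 f) : PowerSeries.X ^ (d + 1) ∣ f := by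
  obtain ⟨g, hg, rfl⟩ := hf
  exact pow_succ (PowerSeries.X : PowerSeries R) d ▸
    mul_dvd_mul_left _ (PowerSeries.X_dvd_iff.2 hg)

theorem C_mul_X_pow (d : ℕ) (δ : R) :
    HasLeadingTerm d δ (PowerSeries.C δ * PowerSeries.X ^ d) :=
  ⟨PowerSeries.C δ, PowerSeries.constantCoeff_C δ, mul_comm _ _⟩

theorem X_pow (d : ℕ) : HasLeadingTerm d (1 : R) (PowerSeries.X ^ d) := by
  simpa using C_mul_X_pow d (1 : R)

theorem add (hf : HasLeadingTerm d δ f) (hg : HasLeadingTerm d ε g) :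
    HasLeadingTerm d (δ + ε) (f + g) := by
  obtain ⟨f, rfl, rfl⟩ := hf
  obtain ⟨g, rfl, rfl⟩ := hg
  exact ⟨f + g, map_add _ _ _, (mul_add _ _ _).symm⟩

theorem sub (hf : HasLeadingTerm d δ f) (hg : HasLeadingTerm d ε g) :
    HasLeadingTerm d (δ - ε) (f - g) := by
  obtain ⟨f, rfl, rfl⟩ := hf
  obtain ⟨g, rfl, rfl⟩ := hg
  exact ⟨f - g, map_sub _ _ _, (mul_sub _ _ _).symm⟩

theorem mul (hf : HasLeadingTerm d δ f) (hg : HasLeadingTerm e ε g) :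
    HasLeadingTerm (d + e) (δ * ε) (f * g) := by
  obtain ⟨f, rfl, rfl⟩ := hf
  obtain ⟨g, rfl, rfl⟩ := hg
  exact ⟨f * g, map_mul _ _ _, by ring⟩

theorem mul_right (hf : HasLeadingTerm d δ f) (g : PowerSeries R) :
    HasLeadingTerm d (δ * PowerSeries.constantCoeff g) (f * g) :=
  hf.mul (e := 0) ⟨g, rfl, by rw [pow_zero, one_mul]⟩

end HasLeadingTerm

theorem constantCoeff_eq_of_X_pow_dvd_sub {d : ℕ} (hd : d ≠ 0) {p q : PowerSeries R}
    (h : PowerSeries.X ^ d ∣ q - p) :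
    PowerSeries.constantCoeff q = PowerSeries.constantCoeff p := by
  rw [← sub_eq_zero, ← map_sub, ← PowerSeries.X_dvd_iff]
  exact (dvd_pow_self _ hd).trans h

theorem HasLeadingTerm.mul_sub_mul {d : ℕ} {δ δ' : R} {p q p' q' : PowerSeries R}
    (hp' : PowerSeries.constantCoeff p' = 1) (hq : PowerSeries.constantCoeff q = 1)
    (h : HasLeadingTerm d δ (q - p)) (h' : HasLeadingTerm d δ' (q' - p')) :
    HasLeadingTerm d (δ + δ') (q * q' - p * p') := by
  have key := (h.mul_right p').add (h'.mul_right q)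
  rw [hp', hq, mul_one, mul_one] at key
  convert! key using 1
  ring

theorem HasLeadingTerm.prod_sub_prod {ι : Type*} {d : ℕ} {δ : ι → R} {p q : ι → PowerSeries R}
    (hp : ∀ i, PowerSeries.constantCoeff (p i) = 1)
    (hq : ∀ i, PowerSeries.constantCoeff (q i) = 1)
    (h : ∀ i, HasLeadingTerm d (δ i) (q i - p i)) (s : Finset ι) :
    HasLeadingTerm d (∑ i ∈ s, δ i) (∏ i ∈ s, q i - ∏ i ∈ s, p i) := by
  classical
  induction s using Finset.induction_on with
  | empty => simpa using of_X_pow_succ_dvd (dvd_zero _)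
  | insert a s ha ih =>
    rw [Finset.sum_insert ha, Finset.prod_insert ha, Finset.prod_insert ha]
    exact mul_sub_mul (by simp [hp]) (hq a) (h a) ih

theorem HasLeadingTerm.pow_sub_pow {d : ℕ} {δ : R} {p q : PowerSeries R}
    (hp : PowerSeries.constantCoeff p = 1) (hq : PowerSeries.constantCoeff q = 1)
    (h : HasLeadingTerm d δ (q - p)) (t : ℕ) : HasLeadingTerm d (t * δ) (q ^ t - p ^ t) := by
  simpa using prod_sub_prod (ι := Fin t) (fun _ => hp) (fun _ => hq) (fun _ => h) .univ

theorem constantCoeff_prod_pow_eq_one {ι : Type*} [Fintype ι] {p : ι → PowerSeries R}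
    (hp : ∀ i, PowerSeries.constantCoeff (p i) = 1) (α : ι → ℕ) :
    PowerSeries.constantCoeff (∏ i, p i ^ α i) = 1 := by
  simp [hp]

theorem HasLeadingTerm.prod_pow_sub_prod_pow {ι : Type*} [Fintype ι] {d : ℕ} {δ : ι → R}
    {p q : ι → PowerSeries R} (hp : ∀ i, PowerSeries.constantCoeff (p i) = 1)
    (hq : ∀ i, PowerSeries.constantCoeff (q i) = 1)
    (h : ∀ i, HasLeadingTerm d (δ i) (q i - p i)) (α : ι → ℕ) :
    HasLeadingTerm d (∑ i, α i * δ i) (∏ i, q i ^ α i - ∏ i, p i ^ α i) :=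
  prod_sub_prod (fun i => by simp [hp]) (fun i => by simp [hq])
    (fun i => pow_sub_pow (hp i) (hq i) (h i) (α i)) _

theorem hasSubst_X_mul (G : PowerSeries R) : PowerSeries.HasSubst (PowerSeries.X * G) :=
  PowerSeries.HasSubst.of_constantCoeff_zero' (by simp)

theorem X_pow_succ_dvd_subst_sub_self {r : ℕ} {G : PowerSeries R}
    (hG : PowerSeries.X ^ r ∣ G - 1) (f : PowerSeries R) :
    PowerSeries.X ^ (r + 1) ∣ f.subst (PowerSeries.X * G) - f := by
  set g := f - PowerSeries.C (PowerSeries.constantCoeff f) with hg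
  have hg₁ : g ∈ orderIdeal Unit R 1 := by
    rw [← X_pow_dvd_iff_mem_orderIdeal, pow_one, PowerSeries.X_dvd_iff]
    simp [hg]
  have hGX : PowerSeries.X * G - PowerSeries.X ∈ orderIdeal Unit R (r + 1) := by
    rw [← X_pow_dvd_iff_mem_orderIdeal, pow_succ', ← mul_sub_one]
    exact mul_dvd_mul_left _ hG
  have key : g.subst (PowerSeries.X * G) - g.subst PowerSeries.X ∈ orderIdeal Unit R (r + 1) :=
    subst_sub_subst_mem_orderIdeal (fun _ => X_pow_dvd_iff_mem_orderIdeal.1 (by simp))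
      (fun _ => X_pow_dvd_iff_mem_orderIdeal.1 (by simp)) (fun _ => hGX) hg₁
  rw [PowerSeries.X_subst, hg, PowerSeries.subst_sub (hasSubst_X_mul G), PowerSeries.subst_C] at key
  rw [X_pow_dvd_iff_mem_orderIdeal]
  convert! key using 1
  exact (sub_sub_sub_cancel_right _ _ _).symm

theorem HasLeadingTerm.subst_X_mul_sub_self {d r : ℕ} {δ Λ : R} {f G : PowerSeries R}
    (hf : HasLeadingTerm d δ f) (hr : r ≠ 0) (hG : HasLeadingTerm r Λ (G - 1)) :
    HasLeadingTerm (d + r) (d * Λ * δ) (f.subst (PowerSeries.X * G) - f) := by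
  obtain ⟨g, hg, rfl⟩ := hf
  set g' := g.subst (PowerSeries.X * G)
  have hG₀ : PowerSeries.constantCoeff G = 1 := by
    rw [constantCoeff_eq_of_X_pow_dvd_sub hr hG.X_pow_dvd, map_one]
  have hpow : HasLeadingTerm r (d * Λ) (G ^ d - 1) := by
    simpa using pow_sub_pow (map_one _) hG₀ hG d
  have hg' : PowerSeries.X ^ (r + 1) ∣ g' - g := X_pow_succ_dvd_subst_sub_self hG.X_pow_dvd g
  have hg'₀ : PowerSeries.constantCoeff g' = δ :=
    (constantCoeff_eq_of_X_pow_dvd_sub (Nat.succ_ne_zero r) hg').trans hg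
  have hsubst : (PowerSeries.X ^ d * g).subst (PowerSeries.X * G)
      = (PowerSeries.X * G) ^ d * g' := by
    rw [PowerSeries.subst_mul (hasSubst_X_mul G), PowerSeries.subst_pow (hasSubst_X_mul G),
      PowerSeries.subst_X (hasSubst_X_mul G)]
  have key := (X_pow (R := R) d).mul ((hpow.mul_right g').add (of_X_pow_succ_dvd hg'))
  rw [hg'₀] at key
  rw [hsubst]
  convert! key using 1 <;> ring

end LeadingTerm

section ConjDefect

variable {ι : Type*} [Fintype ι] {R : Type*} [CommRing R]

/-- The defect of `z_j ↦ z_j p_j(z ^ α)` as a conjugation from `z_j ↦ z_j h_j(z ^ α)` to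
`z_j ↦ z_j (1 + c_j z ^ (r α) + μ β_j z ^ (2 r α))`: with `u = z ^ α`, the `j`-th components of
both sides of the conjugation equation are `z_j` times a power series in `u`, and the defect is
the difference of these. -/
noncomputable def conjDefect (r : ℕ) (α : ι → ℕ) (c β : ι → R) (h p : ι → PowerSeries R) (μ : R)
    (j : ι) : PowerSeries R :=
  h j * (p j).subst (PowerSeries.X * ∏ i, h i ^ α i)
    - p j * (1 + PowerSeries.C (c j) * (PowerSeries.X * ∏ i, p i ^ α i) ^ r
      + PowerSeries.C (μ * β j) * (PowerSeries.X * ∏ i, p i ^ α i) ^ (2 * r))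

variable {r : ℕ} {α : ι → ℕ} {c β : ι → R} {h : ι → PowerSeries R}

theorem hasLeadingTerm_conjDefect_sub_conjDefect (hr : r ≠ 0)
    (hh : ∀ j, HasLeadingTerm r (c j) (h j - 1)) {d : ℕ} (hd : d ≠ 0) {δ : ι → R}
    {p q : ι → PowerSeries R} (hp : ∀ j, PowerSeries.constantCoeff (p j) = 1)
    (hqp : ∀ j, HasLeadingTerm d (δ j) (q j - p j)) {μ μ' ν : R}
    (hμ : HasLeadingTerm (d + r) ν (PowerSeries.C (μ' - μ) * PowerSeries.X ^ (2 * r))) (j : ι) :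
    HasLeadingTerm (d + r) (d * (∑ i, α i * c i) * δ j - r * c j * ∑ i, α i * δ i - ν * β j)
      (conjDefect r α c β h q μ' j - conjDefect r α c β h p μ j) := by
  have hh₀ (i : ι) : PowerSeries.constantCoeff (h i) = 1 :=
    (constantCoeff_eq_of_X_pow_dvd_sub hr (hh i).X_pow_dvd).trans (map_one _)
  have hq (i : ι) : PowerSeries.constantCoeff (q i) = 1 :=
    (constantCoeff_eq_of_X_pow_dvd_sub hd (hqp i).X_pow_dvd).trans (hp i)
  have hG : HasLeadingTerm r (∑ i, α i * c i) (∏ i, h i ^ α i - 1) := by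
    simpa using HasLeadingTerm.prod_pow_sub_prod_pow (fun _ => map_one _) hh₀ hh α
  have hP₀ := constantCoeff_prod_pow_eq_one hp α
  have hQ₀ := constantCoeff_prod_pow_eq_one hq α
  have hQP := HasLeadingTerm.prod_pow_sub_prod_pow hp hq hqp α
  have hpow (t : ℕ) := (hQP.pow_sub_pow hP₀ hQ₀ t).mul_sub_mul (hp j) (by simp [hq]) (hqp j)
  have hsubst := (hqp j).subst_X_mul_sub_self hr hG
  unfold conjDefect
  set G := ∏ i, h i ^ α i
  set P := ∏ i, p i ^ α i
  set Q := ∏ i, q i ^ α i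
  have hD : HasLeadingTerm d (δ j) ((q j - p j).subst (PowerSeries.X * G)) := by
    simpa using (hqp j).add (HasLeadingTerm.of_X_pow_succ_dvd
      ((pow_dvd_pow _ (by omega)).trans hsubst.X_pow_dvd))
  have hlin := (hD.mul (hh j)).add hsubst
  have hc := (hpow r).mul (.C_mul_X_pow r (c j))
  have hμβ := (hμ.mul_right (P ^ (2 * r) * p j)).add (HasLeadingTerm.of_X_pow_succ_dvd
    ((pow_dvd_pow _ (by omega)).trans
      ((HasLeadingTerm.C_mul_X_pow (2 * r) μ').mul (hpow (2 * r))).X_pow_dvd))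
  have key := (hlin.sub hc).sub (hμβ.mul_right (PowerSeries.C (β j)))
  simp only [map_mul, map_pow, hP₀, hp, one_pow, PowerSeries.constantCoeff_C] at key
  convert! key using 1
  · ring
  · simp only [map_sub, map_mul, PowerSeries.subst_sub (hasSubst_X_mul G)]
    ring

theorem X_pow_dvd_conjDefect_of_X_pow_dvd_sub (hr : r ≠ 0)
    (hh : ∀ j, HasLeadingTerm r (c j) (h j - 1)) {d : ℕ} (hd : d ≠ 0) {p q : ι → PowerSeries R}
    (hp : ∀ j, PowerSeries.constantCoeff (p j) = 1) (hqp : ∀ j, PowerSeries.X ^ d ∣ q j - p j)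
    {μ : R} {j : ι} (hdef : PowerSeries.X ^ (d + r) ∣ conjDefect r α c β h p μ j) :
    PowerSeries.X ^ (d + r) ∣ conjDefect r α c β h q μ j := by
  choose δ hδ using fun j => HasLeadingTerm.exists_of_X_pow_dvd (hqp j)
  have hμ : HasLeadingTerm (d + r) 0 (PowerSeries.C (μ - μ) * PowerSeries.X ^ (2 * r)) := by
    simpa using HasLeadingTerm.of_X_pow_succ_dvd (dvd_zero _)
  have key := hasLeadingTerm_conjDefect_sub_conjDefect (α := α) (β := β) hr hh hd hp hδ hμ j
  exact (dvd_iff_dvd_of_dvd_sub key.X_pow_dvd).2 hdef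

theorem X_pow_dvd_conjDefect_one (hh : ∀ j, HasLeadingTerm r (c j) (h j - 1)) (j : ι) :
    PowerSeries.X ^ (1 + r) ∣ conjDefect r α c β h (fun _ => 1) 0 j := by
  have hone : (1 : PowerSeries R).subst (PowerSeries.X * ∏ i, h i ^ α i) = 1 := by
    rw [← PowerSeries.coe_substAlgHom (hasSubst_X_mul _), map_one]
  have key := (hh j).sub (.C_mul_X_pow r (c j))
  rw [sub_self] at key
  simpa [conjDefect, hone, sub_sub, add_comm] using key.X_pow_succ_dvd

end ConjDefect

section Solve

variable {ι : Type*} [Fintype ι] {K : Type*} [Field K] [CharZero K]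
variable {r : ℕ} {α : ι → ℕ} {c β : ι → K} {h : ι → PowerSeries K}

theorem exists_linear_solution {d : ℕ} (hd : d ≠ 0) (hΛ : ∑ i, α i * c i ≠ 0)
    (hβ : ∑ i, α i * β i ≠ 0) (w : ι → K) :
    ∃ (δ : ι → K) (ν : K), (d ≠ r → ν = 0) ∧
      ∀ j, d * (∑ i, α i * c i) * δ j - r * c j * ∑ i, α i * δ i - ν * β j = w j := by
  set Λ := ∑ i, α i * c i
  obtain ⟨S, ν, hν, hS⟩ : ∃ S ν : K, (d ≠ r → ν = 0) ∧
      (d - r) * Λ * S = ∑ i, α i * w i + ν * ∑ i, α i * β i := by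
    rcases eq_or_ne d r with rfl | hdr
    · exact ⟨0, -(∑ i, α i * w i) / ∑ i, α i * β i, fun h => absurd rfl h, by field_simp; ring⟩
    · have hdr' : (d : K) - r ≠ 0 := sub_ne_zero.2 (Nat.cast_injective.ne hdr)
      exact ⟨(∑ i, α i * w i) / ((d - r) * Λ), 0, fun _ => rfl, by field_simp; ring⟩
  have hdΛ : (d : K) * Λ ≠ 0 := mul_ne_zero (Nat.cast_ne_zero.2 hd) hΛ
  let δ (j : ι) : K := (w j + r * c j * S + ν * β j) / (d * Λ)
  have hδ : ∑ i, α i * δ i = S := by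
    have hsum : ∑ i, α i * δ i
        = (∑ i, α i * w i + r * Λ * S + ν * ∑ i, α i * β i) / (d * Λ) := by
      simp only [δ, Λ, Finset.mul_sum, Finset.sum_mul, ← Finset.sum_add_distrib, Finset.sum_div]
      exact Finset.sum_congr rfl fun i _ => by ring
    rw [hsum, div_eq_iff hdΛ]
    linear_combination -hS
  refine ⟨δ, ν, hν, fun j => ?_⟩
  rw [hδ, mul_div_cancel₀ _ hdΛ]
  ring

theorem exists_X_pow_succ_dvd_conjDefect (hr : r ≠ 0)
    (hh : ∀ j, HasLeadingTerm r (c j) (h j - 1)) (hΛ : ∑ i, α i * c i ≠ 0)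
    (hβ : ∑ i, α i * β i ≠ 0) {d : ℕ} (hd : d ≠ 0) {p : ι → PowerSeries K}
    (hp : ∀ j, PowerSeries.constantCoeff (p j) = 1) {μ : K}
    (hdef : ∀ j, PowerSeries.X ^ (d + r) ∣ conjDefect r α c β h p μ j) :
    ∃ (q : ι → PowerSeries K) (μ' : K), (∀ j, PowerSeries.X ^ d ∣ q j - p j) ∧
      (d ≠ r → μ' = μ) ∧ (∀ j, PowerSeries.constantCoeff (q j) = 1) ∧
        ∀ j, PowerSeries.X ^ (d + 1 + r) ∣ conjDefect r α c β h q μ' j := by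
  choose w hw using fun j => HasLeadingTerm.exists_of_X_pow_dvd (hdef j)
  obtain ⟨δ, ν, hν, hδ⟩ := exists_linear_solution (r := r) hd hΛ hβ (fun j => -w j)
  have hμ : HasLeadingTerm (d + r) ν (PowerSeries.C (μ + ν - μ) * PowerSeries.X ^ (2 * r)) := by
    rw [add_sub_cancel_left]
    rcases eq_or_ne d r with rfl | hdr
    · exact two_mul d ▸ .C_mul_X_pow (d + d) ν
    · simpa [hν hdr] using HasLeadingTerm.of_X_pow_succ_dvd (dvd_zero _)
  have hqp (j : ι) :
      HasLeadingTerm d (δ j) (p j + PowerSeries.C (δ j) * PowerSeries.X ^ d - p j) := by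
    rw [add_sub_cancel_left]
    exact .C_mul_X_pow d (δ j)
  refine ⟨_, μ + ν, fun j => (hqp j).X_pow_dvd, fun hdr => by rw [hν hdr, add_zero],
    fun j => (constantCoeff_eq_of_X_pow_dvd_sub hd (hqp j).X_pow_dvd).trans (hp j),
    fun j => Nat.add_right_comm d r 1 ▸ HasLeadingTerm.X_pow_succ_dvd ?_⟩
  have key := (hasLeadingTerm_conjDefect_sub_conjDefect (α := α) (β := β) hr hh hd hp hqp hμ j).add
    (hw j)
  rwa [hδ j, neg_add_cancel, sub_add_cancel] at key

theorem exists_conjDefect_eq_zero (hr : r ≠ 0)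
    (hh : ∀ j, HasLeadingTerm r (c j) (h j - 1)) (hΛ : ∑ i, α i * c i ≠ 0)
    (hβ : ∑ i, α i * β i ≠ 0) :
    ∃ (p : ι → PowerSeries K) (μ : K), (∀ j, PowerSeries.constantCoeff (p j) = 1) ∧
      ∀ j, conjDefect r α c β h p μ j = 0 := by
  have hfinite (d : ℕ) (hd : 1 ≤ d) : ∃ (p : ι → PowerSeries K) (μ : K),
      (∀ j, PowerSeries.constantCoeff (p j) = 1) ∧
        ∀ j, PowerSeries.X ^ (d + r) ∣ conjDefect r α c β h p μ j := by
    induction d, hd using Nat.le_induction with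
    | base => exact ⟨_, 0, fun _ => map_one _, X_pow_dvd_conjDefect_one hh⟩
    | succ d hd ih =>
      obtain ⟨p, μ, hp, hdef⟩ := ih
      have hd₀ : d ≠ 0 := Nat.one_le_iff_ne_zero.1 hd
      obtain ⟨q, μ', -, -, hq⟩ := exists_X_pow_succ_dvd_conjDefect hr hh hΛ hβ hd₀ hp hdef
      exact ⟨q, μ', hq⟩
  -- The coefficient `μ` only changes in degree `r`, so it is fixed before passing to the limit.
  obtain ⟨p₀, μ, hp₀, hdef₀⟩ := hfinite (r + 1) (Nat.le_add_left 1 r)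
  obtain ⟨p, hp⟩ := exists_forall_of_approx (r + 1)
    (fun d (p : ι → PowerSeries K) => (∀ j, PowerSeries.constantCoeff (p j) = 1) ∧
      ∀ j, PowerSeries.X ^ (d + r) ∣ conjDefect r α c β h p μ j)
    (fun d hd p q ⟨hp, hdef⟩ hqp => by
      simp only [← X_pow_dvd_iff_mem_orderIdeal] at hqp
      have hd₀ : d ≠ 0 := by omega
      exact ⟨fun j => (constantCoeff_eq_of_X_pow_dvd_sub hd₀ (hqp j)).trans (hp j),
        fun j => X_pow_dvd_conjDefect_of_X_pow_dvd_sub hr hh hd₀ hp hqp (hdef j)⟩)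
    (fun d hd p ⟨hp, hdef⟩ => by
      simp only [← X_pow_dvd_iff_mem_orderIdeal]
      have hd₀ : d ≠ 0 := by omega
      obtain ⟨q, μ', hqp, hμ, hq⟩ := exists_X_pow_succ_dvd_conjDefect hr hh hΛ hβ hd₀ hp hdef
      obtain rfl := hμ (by omega)
      exact ⟨q, hqp, hq⟩)
    ⟨hp₀, hdef₀⟩
  refine ⟨p, μ, (hp _ le_rfl).1, fun j => eq_zero_of_forall_mem_orderIdeal (r + 1) fun d hd => ?_⟩
  exact X_pow_dvd_iff_mem_orderIdeal.1
    ((pow_dvd_pow _ (Nat.le_add_right d r)).trans ((hp d hd).2 j))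

end Solve

section Weight

variable {σ R : Type*} [CommRing R] {lam : σ → R} {c : R}

/-- `f` is an eigenvector of eigenvalue `c` of the composition with `diag(lam)`: over a domain,
all its monomials `z ^ l` satisfy `lam ^ l = c`. -/
def HasWeight (lam : σ → R) (c : R) (f : MvPowerSeries σ R) : Prop :=
  rescale lam f = C c * f

open Classical in
/-- The part of a series made of the monomials `z ^ l` with `lam ^ l = c`; for `c = lam j`, this is
the resonant part of a `j`-th component. -/
noncomputable def weightPart (lam : σ → R) (c : R) :
    MvPowerSeries σ R →ₗ[R] MvPowerSeries σ R where
  toFun f l := if (l.prod fun i e => lam i ^ e) = c then coeff l f else 0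
  map_add' f g := by
    ext l
    exact (ite_add_zero (P := (l.prod fun i e => lam i ^ e) = c)).trans rfl
  map_smul' a f := by
    ext l
    exact (mul_ite_zero _ _ _).symm

open Classical in
theorem coeff_weightPart (l : σ →₀ ℕ) (f : MvPowerSeries σ R) :
    coeff l (weightPart lam c f) = if (l.prod fun i e => lam i ^ e) = c then coeff l f else 0 :=
  rfl

theorem weightPart_mem_orderIdeal {d : ℕ} {f : MvPowerSeries σ R} (hf : f ∈ orderIdeal σ R d) :
    weightPart lam c f ∈ orderIdeal σ R d :=
  mem_orderIdeal.2 fun l hl => by rw [coeff_weightPart, mem_orderIdeal.1 hf l hl, ite_self]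

theorem hasWeight_weightPart (f : MvPowerSeries σ R) : HasWeight lam c (weightPart lam c f) := by
  ext l
  rw [coeff_rescale, coeff_C_mul, coeff_weightPart]
  split_ifs with h
  · rw [h]
  · rw [mul_zero, mul_zero]

theorem weightPart_weightPart (f : MvPowerSeries σ R) :
    weightPart lam c (weightPart lam c f) = weightPart lam c f := by
  ext l
  simp only [coeff_weightPart]
  split_ifs <;> rfl

theorem HasWeight.prod_pow_eq [IsDomain R] {f : MvPowerSeries σ R} (hf : HasWeight lam c f)
    {l : σ →₀ ℕ} (hl : coeff l f ≠ 0) : (l.prod fun i e => lam i ^ e) = c :=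
  mul_right_cancel₀ hl (by simpa [coeff_rescale] using congrArg (coeff l) hf)

theorem HasWeight.weightPart_eq [IsDomain R] {f : MvPowerSeries σ R} (hf : HasWeight lam c f) :
    weightPart lam c f = f := by
  ext l
  rw [coeff_weightPart]
  by_cases hl : coeff l f = 0
  · rw [hl, ite_self]
  · rw [if_pos (hf.prod_pow_eq hl)]

theorem hasWeight_monomial (l : σ →₀ ℕ) (a : R) :
    HasWeight lam (l.prod fun i e => lam i ^ e) (monomial l a) := by
  classical
  ext k
  rw [coeff_rescale, coeff_C_mul, coeff_monomial]
  split_ifs with h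
  · rw [h]
  · rw [mul_zero, mul_zero]

theorem hasWeight_X (j : σ) : HasWeight lam (lam j) (X j : MvPowerSeries σ R) := by
  simpa [X] using hasWeight_monomial (lam := lam) (Finsupp.single j 1) (1 : R)

theorem HasWeight.add {f g : MvPowerSeries σ R} (hf : HasWeight lam c f)
    (hg : HasWeight lam c g) : HasWeight lam c (f + g) := by
  rw [HasWeight, map_add, hf, hg, mul_add]

theorem HasWeight.sub {f g : MvPowerSeries σ R} (hf : HasWeight lam c f)
    (hg : HasWeight lam c g) : HasWeight lam c (f - g) := by
  rw [HasWeight, map_sub, hf, hg, mul_sub]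

theorem HasWeight.mul {c' : R} {f g : MvPowerSeries σ R} (hf : HasWeight lam c f)
    (hg : HasWeight lam c' g) : HasWeight lam (c * c') (f * g) := by
  rw [HasWeight, map_mul, hf, hg, map_mul]
  ring

theorem hasWeight_C (a : R) : HasWeight lam 1 (C a : MvPowerSeries σ R) := by
  simpa [monomial_zero_eq_C_apply] using hasWeight_monomial (lam := lam) (0 : σ →₀ ℕ) a

/-- The linearization at the identity of the conjugation equation to a resonant normal form: the
non-resonant part of `f` stands for the variation of the conjugation, its resonant part for that
of the normal form. -/
noncomputable def homologicalOp (lam : σ → R) (c : R) (f : MvPowerSeries σ R) :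
    MvPowerSeries σ R :=
  rescale lam (f - weightPart lam c f) - C c * (f - weightPart lam c f) - weightPart lam c f

open Classical in
theorem coeff_homologicalOp (l : σ →₀ ℕ) (f : MvPowerSeries σ R) :
    coeff l (homologicalOp lam c f) =
      (if (l.prod fun i e => lam i ^ e) = c then -1 else (l.prod fun i e => lam i ^ e) - c)
        * coeff l f := by
  simp only [homologicalOp, map_sub, coeff_rescale, coeff_C_mul, coeff_weightPart]
  split_ifs <;> ring

theorem homologicalOp_mem_orderIdeal_iff [IsDomain R] {d : ℕ} {f : MvPowerSeries σ R} :
    homologicalOp lam c f ∈ orderIdeal σ R d ↔ f ∈ orderIdeal σ R d := by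
  simp only [mem_orderIdeal, coeff_homologicalOp]
  refine forall₂_congr fun l _ => mul_eq_zero_iff_left ?_
  split_ifs with h
  · exact neg_ne_zero.2 one_ne_zero
  · exact sub_ne_zero.2 h

theorem homologicalOp_surjective {K : Type*} [Field K] (lam : σ → K) (c : K) :
    Function.Surjective (homologicalOp lam c) := by
  classical
  intro e
  let f : MvPowerSeries σ K := fun l => coeff l e /
    (if (l.prod fun i e => lam i ^ e) = c then -1 else (l.prod fun i e => lam i ^ e) - c)
  refine ⟨f, ext fun l => ?_⟩
  rw [coeff_homologicalOp]
  refine mul_div_cancel₀ _ ?_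
  split_ifs with h
  · exact neg_ne_zero.2 one_ne_zero
  · exact sub_ne_zero.2 h

end Weight

section TangentToId

variable {σ R : Type*} [CommRing R]

/-- `G` has no constant term and linear part `diag(lam)`. -/
def HasDiagonalLinearPart (lam : σ → R) (G : σ → MvPowerSeries σ R) : Prop :=
  ∀ j, G j - C (lam j) * X j ∈ orderIdeal σ R 2

/-- `Ψ` has no constant term and its linear part is the identity. -/
def IsTangentToId (Ψ : σ → MvPowerSeries σ R) : Prop :=
  ∀ j, Ψ j - X j ∈ orderIdeal σ R 2

theorem HasDiagonalLinearPart.mem_orderIdeal_one {lam : σ → R} {G : σ → MvPowerSeries σ R}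
    (hG : HasDiagonalLinearPart lam G) (j : σ) : G j ∈ orderIdeal σ R 1 :=
  (Submodule.sub_mem_iff_left _ (Ideal.mul_mem_left _ _ (X_mem_orderIdeal j))).1
    (orderIdeal_anti one_le_two (hG j))

variable {Ψ : σ → MvPowerSeries σ R}

theorem isTangentToId_X : IsTangentToId (X : σ → MvPowerSeries σ R) := fun j => by
  rw [sub_self]
  exact zero_mem _

namespace IsTangentToId

theorem mem_orderIdeal_one (hΨ : IsTangentToId Ψ) (j : σ) : Ψ j ∈ orderIdeal σ R 1 :=
  (Submodule.sub_mem_iff_left _ (X_mem_orderIdeal j)).1 (orderIdeal_anti one_le_two (hΨ j))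

variable [Finite σ]

theorem hasSubst (hΨ : IsTangentToId Ψ) : HasSubst Ψ :=
  hasSubst_of_mem_orderIdeal hΨ.mem_orderIdeal_one

theorem subst_sub_self_mem_orderIdeal (hΨ : IsTangentToId Ψ) {d : ℕ} {f : MvPowerSeries σ R}
    (hf : f ∈ orderIdeal σ R d) : f.subst Ψ - f ∈ orderIdeal σ R (d + 1) := by
  have h := subst_sub_subst_mem_orderIdeal hΨ.mem_orderIdeal_one X_mem_orderIdeal hΨ hf
  rwa [subst_self, id, add_comm] at h

theorem subst_mem_orderIdeal_iff (hΨ : IsTangentToId Ψ) {d : ℕ} {f : MvPowerSeries σ R} :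
    f.subst Ψ ∈ orderIdeal σ R d ↔ f ∈ orderIdeal σ R d := by
  refine ⟨fun h => ?_, subst_mem_orderIdeal hΨ.mem_orderIdeal_one⟩
  induction d with
  | zero => exact mem_orderIdeal_zero f
  | succ d ih =>
    have hf := ih (orderIdeal_anti d.le_succ h)
    exact (Submodule.sub_mem_iff_right _ h).1 (hΨ.subst_sub_self_mem_orderIdeal hf)

theorem subst_injective (hΨ : IsTangentToId Ψ) :
    Function.Injective (subst Ψ : MvPowerSeries σ R → MvPowerSeries σ R) := by
  intro f g (hfg : f.subst Ψ = g.subst Ψ)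
  refine sub_eq_zero.1 (eq_zero_of_forall_mem_orderIdeal 0 fun d _ => ?_)
  rw [← hΨ.subst_mem_orderIdeal_iff, subst_sub hΨ.hasSubst, hfg, sub_self]
  exact zero_mem _

theorem subst_surjective (hΨ : IsTangentToId Ψ) :
    Function.Surjective (subst Ψ : MvPowerSeries σ R → MvPowerSeries σ R) := by
  intro f
  obtain ⟨g, hg⟩ := exists_forall_of_approx 0
    (fun d (g : Unit → MvPowerSeries σ R) => f - (g ()).subst Ψ ∈ orderIdeal σ R d)
    (fun d _ g g' hg hgg' => by
      have h := subst_mem_orderIdeal hΨ.mem_orderIdeal_one (hgg' ())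
      rw [subst_sub hΨ.hasSubst] at h
      simpa using sub_mem hg h)
    (fun d _ g hg => by
      refine ⟨fun _ => g () + (f - (g ()).subst Ψ), fun _ => by rwa [add_sub_cancel_left], ?_⟩
      have h := neg_mem (hΨ.subst_sub_self_mem_orderIdeal hg)
      rw [subst_add hΨ.hasSubst]
      convert! h using 1
      ring)
    (x₀ := 0) (mem_orderIdeal_zero _)
  exact ⟨g (), (sub_eq_zero.1 (eq_zero_of_forall_mem_orderIdeal 0 hg)).symm⟩

theorem exists_conj (hΨ : IsTangentToId Ψ) {lam : σ → R} {H : σ → MvPowerSeries σ R}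
    (hH : HasDiagonalLinearPart lam H) :
    ∃ A, HasDiagonalLinearPart lam A ∧ ∀ j, (Ψ j).subst H = (A j).subst Ψ := by
  have sH := hasSubst_of_mem_orderIdeal hH.mem_orderIdeal_one
  choose A hA using fun j => hΨ.subst_surjective ((Ψ j).subst H)
  refine ⟨A, fun j => hΨ.subst_mem_orderIdeal_iff.1 ?_, fun j => (hA j).symm⟩
  have h₁ := subst_mem_orderIdeal hH.mem_orderIdeal_one (hΨ j)
  have h₂ := Ideal.mul_mem_left _ (C (lam j)) (hΨ j)
  rw [subst_sub sH, subst_X sH] at h₁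
  rw [subst_sub hΨ.hasSubst, subst_mul hΨ.hasSubst, subst_C, subst_X hΨ.hasSubst, hA]
  convert! sub_mem (add_mem h₁ (hH j)) h₂ using 1
  ring

end IsTangentToId

section SubstWeight

variable {lam : σ → R} {c : R}

theorem rescale_subst_of_hasWeight (hΨ : ∀ j, HasWeight lam (lam j) (Ψ j)) (sΨ : HasSubst Ψ)
    (f : MvPowerSeries σ R) : rescale lam (f.subst Ψ) = (rescale lam f).subst Ψ := by
  have h : (fun j => (Ψ j).subst (lam • X)) =
      fun j => ((lam • X) j : MvPowerSeries σ R).subst Ψ := by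
    funext j
    rw [← rescale_eq_subst, hΨ j, Pi.smul_apply', subst_smul sΨ, subst_X sΨ, smul_eq_C_mul]
  rw [rescale_eq_subst, rescale_eq_subst, subst_comp_subst_apply sΨ (HasSubst.smul_X lam), h,
    subst_comp_subst_apply (HasSubst.smul_X lam) sΨ]

theorem HasWeight.subst (hΨ : ∀ j, HasWeight lam (lam j) (Ψ j)) (sΨ : HasSubst Ψ)
    {f : MvPowerSeries σ R} (hf : HasWeight lam c f) : HasWeight lam c (f.subst Ψ) := by
  rw [HasWeight, rescale_subst_of_hasWeight hΨ sΨ, hf, subst_mul sΨ, subst_C]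

theorem IsTangentToId.hasWeight_of_subst [Finite σ] (hΨ : IsTangentToId Ψ)
    (hΨw : ∀ j, HasWeight lam (lam j) (Ψ j)) {f : MvPowerSeries σ R}
    (hf : HasWeight lam c (f.subst Ψ)) : HasWeight lam c f := by
  refine hΨ.subst_injective ?_
  rw [← rescale_subst_of_hasWeight hΨw hΨ.hasSubst, hf, subst_mul hΨ.hasSubst, subst_C]

end SubstWeight

end TangentToId

section PoincareDulac

variable {σ R : Type*} [CommRing R] {lam : σ → R} {G : σ → MvPowerSeries σ R}

/-- The map tangent to the identity whose non-linear terms are the non-resonant terms of `x`. -/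
noncomputable def nonresonantMap (lam : σ → R) (x : σ → MvPowerSeries σ R) (j : σ) :
    MvPowerSeries σ R :=
  X j + (x j - weightPart lam (lam j) (x j))

/-- The map with linear part `diag(lam)` whose non-linear terms are the resonant terms of `x`. -/
noncomputable def resonantMap (lam : σ → R) (x : σ → MvPowerSeries σ R) (j : σ) :
    MvPowerSeries σ R :=
  C (lam j) * X j + weightPart lam (lam j) (x j)

variable {x : σ → MvPowerSeries σ R}

theorem isTangentToId_nonresonantMap (hx : ∀ j, x j ∈ orderIdeal σ R 2) :
    IsTangentToId (nonresonantMap lam x) := fun j => by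
  rw [nonresonantMap, add_sub_cancel_left]
  exact sub_mem (hx j) (weightPart_mem_orderIdeal (hx j))

theorem hasDiagonalLinearPart_resonantMap (hx : ∀ j, x j ∈ orderIdeal σ R 2) :
    HasDiagonalLinearPart lam (resonantMap lam x) := fun j => by
  rw [resonantMap, add_sub_cancel_left]
  exact weightPart_mem_orderIdeal (hx j)

theorem hasWeight_resonantMap (x : σ → MvPowerSeries σ R) (j : σ) :
    HasWeight lam (lam j) (resonantMap lam x j) := by
  have h := (hasWeight_C (lam j)).mul (hasWeight_X (lam := lam) j)
  rw [one_mul] at h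
  exact h.add (hasWeight_weightPart (x j))

theorem weightPart_nonresonantMap_sub_X (x : σ → MvPowerSeries σ R) (j : σ) :
    weightPart lam (lam j) (nonresonantMap lam x j - X j) = 0 := by
  rw [nonresonantMap, add_sub_cancel_left, map_sub, weightPart_weightPart, sub_self]

variable [Finite σ]

theorem conj_sub_conj_sub_homologicalOp_mem_orderIdeal
    {Ψ Ψ' : σ → MvPowerSeries σ R} (hG : HasDiagonalLinearPart lam G) (hΨ : IsTangentToId Ψ)
    (hΨ' : IsTangentToId Ψ') {η η' Δ : MvPowerSeries σ R} {d : ℕ} (hΔ : Δ ∈ orderIdeal σ R d)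
    {j : σ} (hΨΔ : Ψ' j - Ψ j = Δ - weightPart lam (lam j) Δ)
    (hηΔ : η' - η = weightPart lam (lam j) Δ)
    (hη : (η - C (lam j) * X j).subst Ψ' - (η - C (lam j) * X j).subst Ψ
      ∈ orderIdeal σ R (d + 1)) :
    ((Ψ' j).subst G - η'.subst Ψ') - ((Ψ j).subst G - η.subst Ψ) - homologicalOp lam (lam j) Δ
      ∈ orderIdeal σ R (d + 1) := by
  have hG₁ := hG.mem_orderIdeal_one
  have sG := hasSubst_of_mem_orderIdeal hG₁
  have hG' : ∀ i, G i - (lam • X) i ∈ orderIdeal σ R (1 + 1) := fun i => by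
    simpa only [Pi.smul_apply', smul_eq_C_mul] using hG i
  have hlam : ∀ i, (lam • X) i ∈ orderIdeal σ R 1 := fun i => by
    simpa only [Pi.smul_apply', smul_eq_C_mul] using Ideal.mul_mem_left _ _ (X_mem_orderIdeal i)
  have hw := weightPart_mem_orderIdeal (lam := lam) (c := lam j) hΔ
  have h₁ := subst_sub_subst_mem_orderIdeal hG₁ hlam hG' (sub_mem hΔ hw)
  have h₂ := hΨ'.subst_sub_self_mem_orderIdeal hw
  rw [add_comm 1 d, ← rescale_eq_subst, ← hΨΔ, subst_sub sG, hΨΔ] at h₁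
  rw [← hηΔ, subst_sub hΨ'.hasSubst, hηΔ] at h₂
  simp only [subst_sub hΨ'.hasSubst, subst_sub hΨ.hasSubst, subst_mul hΨ'.hasSubst,
    subst_mul hΨ.hasSubst, subst_C, subst_X hΨ'.hasSubst, subst_X hΨ.hasSubst] at hη
  rw [homologicalOp]
  convert! sub_mem (sub_mem h₁ h₂) hη using 1
  linear_combination -C (lam j) * hΨΔ

/-- The defect of `nonresonantMap lam x` as a conjugation from `G` to `resonantMap lam x`. -/
noncomputable def normalizationDefect (lam : σ → R) (G x : σ → MvPowerSeries σ R) (j : σ) :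
    MvPowerSeries σ R :=
  (nonresonantMap lam x j).subst G - (resonantMap lam x j).subst (nonresonantMap lam x)

theorem normalizationDefect_sub_mem_orderIdeal (hG : HasDiagonalLinearPart lam G)
    {y : σ → MvPowerSeries σ R} (hx : ∀ j, x j ∈ orderIdeal σ R 2) {d : ℕ} (hd : 2 ≤ d)
    (hxy : ∀ j, y j - x j ∈ orderIdeal σ R d) (j : σ) :
    normalizationDefect lam G y j - normalizationDefect lam G x j
      - homologicalOp lam (lam j) (y j - x j) ∈ orderIdeal σ R (d + 1) := by
  have hy (i : σ) : y i ∈ orderIdeal σ R 2 :=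
    (Submodule.sub_mem_iff_left _ (hx i)).1 (orderIdeal_anti hd (hxy i))
  have hΨx := isTangentToId_nonresonantMap (lam := lam) hx
  have hΨy := isTangentToId_nonresonantMap (lam := lam) hy
  have hΨ (i : σ) : nonresonantMap lam y i - nonresonantMap lam x i
      = (y i - x i) - weightPart lam (lam i) (y i - x i) := by
    simp only [nonresonantMap, map_sub]
    ring
  refine conj_sub_conj_sub_homologicalOp_mem_orderIdeal hG hΨx hΨy (hxy j) (hΨ j)
    (by rw [resonantMap, resonantMap, map_sub, add_sub_add_left_eq_sub]) ?_
  obtain ⟨d, rfl⟩ := Nat.exists_eq_add_of_le' (one_le_two.trans hd)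
  refine subst_sub_subst_mem_orderIdeal (d := d) (e := 2) hΨy.mem_orderIdeal_one
    hΨx.mem_orderIdeal_one (fun i => ?_) (hasDiagonalLinearPart_resonantMap hx j)
  rw [hΨ]
  exact sub_mem (hxy i) (weightPart_mem_orderIdeal (hxy i))

theorem normalizationDefect_zero_mem_orderIdeal (hG : HasDiagonalLinearPart lam G) (j : σ) :
    normalizationDefect lam G 0 j ∈ orderIdeal σ R 2 := by
  have hX : nonresonantMap lam (0 : σ → MvPowerSeries σ R) = X := by
    funext i
    simp [nonresonantMap]
  rw [normalizationDefect, hX, resonantMap, subst_self,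
    subst_X (hasSubst_of_mem_orderIdeal hG.mem_orderIdeal_one)]
  simpa using hG j

theorem exists_poincareDulac {K : Type*} [Field K] {lam : σ → K} {G : σ → MvPowerSeries σ K}
    (hG : HasDiagonalLinearPart lam G) :
    ∃ Ψ H : σ → MvPowerSeries σ K, IsTangentToId Ψ ∧ HasDiagonalLinearPart lam H ∧
      (∀ j, (Ψ j).subst G = (H j).subst Ψ) ∧
      (∀ j, weightPart lam (lam j) (Ψ j - X j) = 0) ∧ ∀ j, HasWeight lam (lam j) (H j) := by
  obtain ⟨x, hx⟩ := exists_forall_of_approx 2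
    (fun d (x : σ → MvPowerSeries σ K) => (∀ j, x j ∈ orderIdeal σ K 2) ∧
      ∀ j, normalizationDefect lam G x j ∈ orderIdeal σ K d)
    (fun d hd x y ⟨hx, hdef⟩ hxy => by
      refine ⟨fun j => (Submodule.sub_mem_iff_left _ (hx j)).1 (orderIdeal_anti hd (hxy j)),
        fun j => (Submodule.sub_mem_iff_left _ (hdef j)).1 ?_⟩
      have h := orderIdeal_anti d.le_succ (normalizationDefect_sub_mem_orderIdeal hG hx hd hxy j)
      exact (Submodule.sub_mem_iff_left _ (homologicalOp_mem_orderIdeal_iff.2 (hxy j))).1 h)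
    (fun d hd x ⟨hx, hdef⟩ => by
      choose Δ hΔ using fun j =>
        homologicalOp_surjective lam (lam j) (-normalizationDefect lam G x j)
      have hΔd (j : σ) : x j + Δ j - x j ∈ orderIdeal σ K d := by
        rw [add_sub_cancel_left, ← homologicalOp_mem_orderIdeal_iff, hΔ]
        exact neg_mem (hdef j)
      refine ⟨fun j => x j + Δ j, hΔd,
        fun j => (Submodule.sub_mem_iff_left _ (hx j)).1 (orderIdeal_anti hd (hΔd j)), fun j => ?_⟩
      have h := normalizationDefect_sub_mem_orderIdeal hG hx hd hΔd j
      rwa [add_sub_cancel_left, hΔ, sub_neg_eq_add, sub_add_cancel] at h)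
    (x₀ := 0) ⟨fun _ => zero_mem _, normalizationDefect_zero_mem_orderIdeal hG⟩
  have hx₂ := (hx 2 le_rfl).1
  exact ⟨nonresonantMap lam x, resonantMap lam x, isTangentToId_nonresonantMap hx₂,
    hasDiagonalLinearPart_resonantMap hx₂,
    fun j => sub_eq_zero.1 (eq_zero_of_forall_mem_orderIdeal 2 fun d hd => (hx d hd).2 j),
    weightPart_nonresonantMap_sub_X x, hasWeight_resonantMap x⟩

theorem sub_mem_orderIdeal_of_poincareDulac [IsDomain R] {Ψ H : σ → MvPowerSeries σ R}
    (hG : HasDiagonalLinearPart lam G) (hΨ : IsTangentToId Ψ) (hH : HasDiagonalLinearPart lam H)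
    (hconj : ∀ j, (Ψ j).subst G = (H j).subst Ψ)
    (hΨw : ∀ j, weightPart lam (lam j) (Ψ j - X j) = 0) (hHw : ∀ j, HasWeight lam (lam j) (H j))
    {e : ℕ} (he : 2 ≤ e) {j : σ} {f : MvPowerSeries σ R}
    (hf : f ∈ orderIdeal σ R e) (hfw : HasWeight lam (lam j) f)
    (hGf : G j - (C (lam j) * X j + f) ∈ orderIdeal σ R (e + 1)) :
    H j - (C (lam j) * X j + f) ∈ orderIdeal σ R (e + 1) := by
  have hlX : HasWeight lam (lam j) (C (lam j) * X j : MvPowerSeries σ R) := by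
    simpa only [one_mul] using (hasWeight_C (lam j)).mul (hasWeight_X (lam := lam) j)
  have hw : weightPart lam (lam j) (H j - (C (lam j) * X j + f)) = H j - (C (lam j) * X j + f) :=
    ((hHw j).sub (hlX.add hfw)).weightPart_eq
  suffices h : ∀ d, 2 ≤ d → d ≤ e + 1 →
      (Ψ j - X j) + (H j - (C (lam j) * X j + f)) ∈ orderIdeal σ R d by
    have h' := weightPart_mem_orderIdeal (lam := lam) (c := lam j) (h (e + 1) (by omega) le_rfl)
    rwa [map_add, hΨw, zero_add, hw] at h'
  intro d hd
  induction d, hd using Nat.le_induction with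
  | base =>
    intro _
    have h := sub_mem (hH j) (orderIdeal_anti he hf)
    rw [sub_sub] at h
    exact add_mem (hΨ j) h
  | succ d _ ih =>
    intro hde
    have hη := orderIdeal_anti hde (hΨ.subst_sub_self_mem_orderIdeal hf)
    have h := conj_sub_conj_sub_homologicalOp_mem_orderIdeal hG isTangentToId_X hΨ
      (ih (d.le_succ.trans hde)) (η := C (lam j) * X j + f) (η' := H j)
      (by rw [map_add, hΨw, zero_add, hw]; ring) (by rw [map_add, hΨw, zero_add, hw])
      (by rwa [add_sub_cancel_left, subst_self])
    rw [hconj, sub_self, zero_sub, subst_self,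
      subst_X (hasSubst_of_mem_orderIdeal hG.mem_orderIdeal_one)] at h
    exact homologicalOp_mem_orderIdeal_iff.1
      ((Submodule.sub_mem_iff_right _ (neg_mem (orderIdeal_anti hde hGf))).1 h)

end PoincareDulac

section Monomial

variable {σ R : Type*} [CommRing R] {α : σ →₀ ℕ}

theorem smul_left_injective_of_ne_zero (hα : α ≠ 0) :
    Function.Injective fun s : ℕ => s • α := by
  intro s t hst
  obtain ⟨i, hi⟩ := Finsupp.ne_iff.1 hα
  exact Nat.eq_of_mul_eq_mul_right (Nat.pos_of_ne_zero hi) (DFunLike.congr_fun hst i)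

theorem coeff_smul_subst_monomial (hα : α ≠ 0) (h : PowerSeries R) (s : ℕ) :
    coeff (s • α) (h.subst (monomial α (1 : R))) = PowerSeries.coeff s h := by
  classical
  rw [PowerSeries.coeff_subst (PowerSeries.HasSubst.monomial hα 1), finsum_eq_single _ s]
  · rw [monomial_pow, one_pow, coeff_monomial_same, smul_eq_mul, mul_one]
  · intro t ht
    rw [monomial_pow, coeff_monomial_ne, smul_zero]
    exact fun h => ht (smul_left_injective_of_ne_zero hα h).symm

theorem coeff_subst_monomial_eq_zero (hα : α ≠ 0) (h : PowerSeries R) {l : σ →₀ ℕ}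
    (hl : ∀ s : ℕ, l ≠ s • α) : coeff l (h.subst (monomial α (1 : R))) = 0 := by
  classical
  rw [PowerSeries.coeff_subst (PowerSeries.HasSubst.monomial hα 1)]
  refine finsum_eq_zero_of_forall_eq_zero fun t => ?_
  rw [monomial_pow, coeff_monomial_ne (hl t), smul_zero]

theorem coeff_smul_add_single_X_mul_subst_monomial (hα : α ≠ 0) (j : σ) (h : PowerSeries R)
    (s : ℕ) : coeff (s • α + Finsupp.single j 1) (X j * h.subst (monomial α (1 : R))) =
      PowerSeries.coeff s h := by
  rw [add_comm, X, coeff_add_monomial_mul, one_mul, coeff_smul_subst_monomial hα]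

theorem exists_eq_X_mul_subst_monomial (hα : α ≠ 0) {j : σ} {f : MvPowerSeries σ R}
    (hf : ∀ l, coeff l f ≠ 0 → ∃ s : ℕ, l = s • α + Finsupp.single j 1) :
    ∃ h : PowerSeries R, f = X j * h.subst (monomial α (1 : R)) := by
  classical
  refine ⟨PowerSeries.mk fun s => coeff (s • α + Finsupp.single j 1) f, ext fun l => ?_⟩
  by_cases hl : ∃ s : ℕ, l = s • α + Finsupp.single j 1
  · obtain ⟨s, rfl⟩ := hl
    rw [coeff_smul_add_single_X_mul_subst_monomial hα, PowerSeries.coeff_mk]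
  · rw [not_imp_comm.1 (hf l) hl, X, coeff_monomial_mul]
    split_ifs with hle
    · rw [coeff_subst_monomial_eq_zero hα _ fun s hs => hl ⟨s, ?_⟩, mul_zero]
      rw [← hs, tsub_add_cancel_of_le hle]
    · rfl

theorem X_pow_succ_dvd_of_X_mul_subst_monomial_mem_orderIdeal (hα : α ≠ 0) {j : σ} {r : ℕ}
    {h : PowerSeries R}
    (hmem : X j * h.subst (monomial α (1 : R)) ∈ orderIdeal σ R (r * α.degree + 2)) :
    PowerSeries.X ^ (r + 1) ∣ h := by
  refine PowerSeries.X_pow_dvd_iff.2 fun s hs => ?_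
  have hsr : s * α.degree ≤ r * α.degree := Nat.mul_le_mul_right _ (Nat.lt_succ_iff.1 hs)
  rw [← coeff_smul_add_single_X_mul_subst_monomial hα j h s]
  exact mem_orderIdeal.1 hmem _ (by simp; omega)

theorem subst_subst_monomial (hα : α ≠ 0) {K : σ → MvPowerSeries σ R} (hK : HasSubst K)
    (p : PowerSeries R) :
    (p.subst (monomial α (1 : R))).subst K = p.subst ((monomial α (1 : R)).subst K) :=
  subst_comp_subst_apply (PowerSeries.HasSubst.monomial hα 1).const hK p

theorem hasWeight_subst_monomial {lam : σ → R} (hα : α ≠ 0)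
    (hlamα : (α.prod fun i e => lam i ^ e) = 1) (p : PowerSeries R) :
    HasWeight lam 1 (p.subst (monomial α (1 : R))) := by
  have hu := hasWeight_monomial (lam := lam) α (1 : R)
  rw [hlamα, HasWeight, map_one C, one_mul] at hu
  rw [HasWeight, rescale_eq_subst, subst_subst_monomial hα (HasSubst.smul_X lam),
    ← rescale_eq_subst, hu, map_one C, one_mul]

end Monomial

section MonomialScaling

variable {ι σ R : Type*} [CommRing R] {e : ι → σ} {α : σ →₀ ℕ}

/-- The map `z_j ↦ z_j p_j(z ^ α)` for the indices `j` in the range of `e`, and `z_j ↦ z_j` for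
the others. -/
noncomputable def monomialScaling (e : ι → σ) (α : σ →₀ ℕ) (p : ι → PowerSeries R) :
    σ → MvPowerSeries σ R :=
  Function.extend e (fun i => X (e i) * (p i).subst (monomial α (1 : R))) X

variable {p : ι → PowerSeries R}

theorem isTangentToId_monomialScaling (he : Function.Injective e) (hα : α ≠ 0)
    (hp : ∀ i, PowerSeries.constantCoeff (p i) = 1) : IsTangentToId (monomialScaling e α p) := by
  intro j
  by_cases hj : ∃ i, e i = j
  · obtain ⟨i, rfl⟩ := hj
    have su := PowerSeries.HasSubst.monomial hα (1 : R)
    have hsub : (p i - 1).subst (monomial α (1 : R)) = (p i).subst (monomial α (1 : R)) - 1 := by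
      rw [← PowerSeries.coe_substAlgHom su, map_sub, map_one (PowerSeries.substAlgHom su)]
    have h : (p i - 1).subst (monomial α (1 : R)) ∈ orderIdeal σ R 1 := by
      refine mem_orderIdeal_one.2 (PowerSeries.constantCoeff_subst_eq_zero ?_ _ (by simp [hp]))
      exact mem_orderIdeal_one.1 (orderIdeal_anti (by
        rwa [Nat.one_le_iff_ne_zero, Ne, Finsupp.degree_eq_zero_iff])
        (monomial_mem_orderIdeal α (1 : R)))
    have h' := mul_mem_orderIdeal (X_mem_orderIdeal (e i)) h
    rwa [hsub, mul_sub, mul_one,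
      ← he.extend_apply (fun i => X (e i) * (p i).subst (monomial α (1 : R))) X] at h'
  · rw [monomialScaling, Function.extend_apply' _ _ _ hj, sub_self]
    exact zero_mem _

theorem hasWeight_monomialScaling {lam : σ → R} (he : Function.Injective e) (hα : α ≠ 0)
    (hlamα : (α.prod fun i e => lam i ^ e) = 1) (j : σ) :
    HasWeight lam (lam j) (monomialScaling e α p j) := by
  by_cases hj : ∃ i, e i = j
  · obtain ⟨i, rfl⟩ := hj
    have h := (hasWeight_X (lam := lam) (e i)).mul (hasWeight_subst_monomial hα hlamα (p i))
    rwa [mul_one, ← he.extend_apply (fun i => X (e i) * (p i).subst (monomial α (1 : R))) X] at h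
  · rw [monomialScaling, Function.extend_apply' _ _ _ hj]
    exact hasWeight_X j

variable [Fintype ι]

theorem prod_pow_eq_prod_comp {M : Type*} [CommMonoid M] (he : Function.Injective e)
    (hαe : ∀ j ∉ Set.range e, α j = 0) (f : σ → M) :
    (α.prod fun j l => f j ^ l) = ∏ i, f (e i) ^ α (e i) := by
  classical
  rw [Finsupp.prod_of_support_subset α (s := Finset.univ.image e) _ _ fun _ _ => pow_zero _]
  · exact Finset.prod_image he.injOn
  · intro j hj
    by_contra hje
    exact Finsupp.mem_support_iff.1 hj (hαe j (by simpa using hje))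

theorem monomial_subst_eq_subst_monomial (he : Function.Injective e) (hα : α ≠ 0)
    (hαe : ∀ j ∉ Set.range e, α j = 0) {K : σ → MvPowerSeries σ R} (hK : HasSubst K)
    {k : ι → PowerSeries R} (hKk : ∀ i, K (e i) = X (e i) * (k i).subst (monomial α (1 : R))) :
    (monomial α (1 : R)).subst K =
      (PowerSeries.X * ∏ i, k i ^ α (e i)).subst (monomial α (1 : R)) := by
  have su := PowerSeries.HasSubst.monomial hα (1 : R)
  have hu : monomial α (1 : R) = ∏ i, X (e i) ^ α (e i) := by
    rw [monomial_one_eq, prod_pow_eq_prod_comp he hαe]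
  calc (monomial α (1 : R)).subst K
      = ∏ i, K (e i) ^ α (e i) := by
        rw [subst_monomial hK, map_one, one_mul, prod_pow_eq_prod_comp he hαe]
    _ = monomial α (1 : R) * ∏ i, (k i).subst (monomial α (1 : R)) ^ α (e i) := by
        simp only [hKk, mul_pow, Finset.prod_mul_distrib, ← hu]
    _ = _ := by
        rw [PowerSeries.subst_mul su, PowerSeries.subst_X su, ← PowerSeries.coe_substAlgHom su,
          map_prod]
        simp only [map_pow, PowerSeries.coe_substAlgHom su]

theorem subst_monomialScaling_of_conjDefect_eq_zero (he : Function.Injective e) (hα : α ≠ 0)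
    (hαe : ∀ j ∉ Set.range e, α j = 0) {lam : ι → R} (hlamα : ∏ i, lam i ^ α (e i) = 1)
    {H : σ → MvPowerSeries σ R} (sH : HasSubst H) (sΨ : HasSubst (monomialScaling e α p))
    {h : ι → PowerSeries R}
    (hHh : ∀ i, H (e i) = X (e i) * (PowerSeries.C (lam i) * h i).subst (monomial α (1 : R)))
    {r : ℕ} {c β : ι → R} {μ : R} {i : ι}
    (hdef : conjDefect r (fun i => α (e i)) c β h p μ i = 0) :
    (monomialScaling e α p (e i)).subst H =
      (C (lam i) * X (e i) * (1 + C (c i) * monomial α (1 : R) ^ r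
        + C (μ * β i) * monomial α (1 : R) ^ (2 * r))).subst (monomialScaling e α p) := by
  have su := PowerSeries.HasSubst.monomial hα (1 : R)
  have hΨ (i : ι) : monomialScaling e α p (e i) = X (e i) * (p i).subst (monomial α (1 : R)) :=
    he.extend_apply _ _ i
  have hφ := monomial_subst_eq_subst_monomial he hα hαe sΨ hΨ
  have hg := monomial_subst_eq_subst_monomial he hα hαe sH hHh
  have hprod : ∏ i, (PowerSeries.C (lam i) * h i) ^ α (e i) = ∏ i, h i ^ α (e i) := by
    simp only [mul_pow, Finset.prod_mul_distrib, ← map_pow, ← map_prod, hlamα, map_one, one_mul]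
  have hdef' := congrArg (PowerSeries.subst (monomial α (1 : R))) (sub_eq_zero.1 hdef)
  have sg := hasSubst_X_mul (∏ i, h i ^ α (e i))
  rw [hprod] at hg
  rw [PowerSeries.subst_mul su, PowerSeries.subst_comp_subst_apply sg su, ← hg] at hdef'
  generalize PowerSeries.X * ∏ i, p i ^ α (e i) = φ at hφ hdef'
  simp only [PowerSeries.subst_mul su, PowerSeries.subst_add su, PowerSeries.subst_pow su,
    PowerSeries.subst_C] at hdef'
  have h_one : (1 : PowerSeries R).subst (monomial α (1 : R)) = 1 := by
    rw [← PowerSeries.coe_substAlgHom su, map_one]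
  have h_one' : (1 : MvPowerSeries σ R).subst (monomialScaling e α p) = 1 := by
    rw [← coe_substAlgHom sΨ, map_one]
  rw [h_one] at hdef'
  rw [hΨ, subst_mul sH, subst_X sH, subst_subst_monomial hα sH, hHh, PowerSeries.subst_mul su,
    PowerSeries.subst_C]
  simp only [subst_mul sΨ, subst_add sΨ, subst_pow sΨ, subst_C, subst_X sΨ, hφ, hΨ, h_one']
  linear_combination C (lam i) * X (e i) * hdef'

end MonomialScaling

section NormalForm

variable {ι σ K : Type*} [Field K] {α : σ →₀ ℕ} {lam : σ → K}

theorem exists_eq_X_mul_subst_of_leading (hα : α ≠ 0) {j : σ} {f : MvPowerSeries σ K}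
    (hf : ∀ l, coeff l f ≠ 0 → ∃ s : ℕ, l = s • α + Finsupp.single j 1) {a b : K} (hb : b ≠ 0)
    {r : ℕ} (hlead : f - (C b * X j + C a * monomial (r • α) 1 * X j)
      ∈ orderIdeal σ K (r * α.degree + 2)) :
    ∃ h : PowerSeries K, f = X j * (PowerSeries.C b * h).subst (monomial α (1 : K)) ∧
      HasLeadingTerm r (a / b) (h - 1) := by
  have su := PowerSeries.HasSubst.monomial hα (1 : K)
  obtain ⟨q, rfl⟩ := exists_eq_X_mul_subst_monomial hα hf
  have hq : X j * (q - (PowerSeries.C b + PowerSeries.C a * PowerSeries.X ^ r)).subst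
      (monomial α (1 : K)) ∈ orderIdeal σ K (r * α.degree + 2) := by
    rw [PowerSeries.subst_sub su, PowerSeries.subst_add su, PowerSeries.subst_mul su,
      PowerSeries.subst_pow su, PowerSeries.subst_X su, PowerSeries.subst_C, PowerSeries.subst_C,
      monomial_pow, one_pow]
    convert! hlead using 1
    ring
  have hdvd := X_pow_succ_dvd_of_X_mul_subst_monomial_mem_orderIdeal hα hq
  have hbb : PowerSeries.C b⁻¹ * PowerSeries.C b = 1 := by
    rw [← map_mul, inv_mul_cancel₀ hb, map_one]
  refine ⟨PowerSeries.C b⁻¹ * q, by rw [mul_left_comm, ← mul_assoc, hbb, one_mul], ?_⟩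
  have h := (HasLeadingTerm.C_mul_X_pow r (a / b)).add
    (HasLeadingTerm.of_X_pow_succ_dvd (hdvd.mul_left (PowerSeries.C b⁻¹)))
  rw [add_zero, div_eq_mul_inv, map_mul] at h
  rw [div_eq_mul_inv]
  convert! h using 1
  linear_combination hbb

variable [Fintype ι] [Finite σ] [CharZero K] {e : ι → σ}

theorem exists_conj_of_hasWeight (he : Function.Injective e) (hα : α ≠ 0)
    (hαe : ∀ j ∉ Set.range e, α j = 0) (hlam : ∀ i, lam (e i) ≠ 0)
    (hlamα : (α.prod fun j l => lam j ^ l) = 1) {H : σ → MvPowerSeries σ K}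
    (hH : HasDiagonalLinearPart lam H) (hHw : ∀ j, HasWeight lam (lam j) (H j))
    (hHα : ∀ i l, coeff l (H (e i)) ≠ 0 → ∃ s : ℕ, l = s • α + Finsupp.single (e i) 1)
    {r : ℕ} (hr : r ≠ 0) {a β : ι → K}
    (hlead : ∀ i, H (e i) - (C (lam (e i)) * X (e i) + C (a i) * monomial (r • α) 1 * X (e i))
      ∈ orderIdeal σ K (r * α.degree + 2))
    (hΛ : ∑ i, a i * α (e i) / lam (e i) ≠ 0) (hβ : ∑ i, β i * α (e i) / lam (e i) ≠ 0) :
    ∃ (Ψ A : σ → MvPowerSeries σ K) (μ : K), IsTangentToId Ψ ∧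
      (∀ j, (Ψ j).subst H = (A j).subst Ψ) ∧ HasDiagonalLinearPart lam A ∧
      (∀ j, HasWeight lam (lam j) (A j)) ∧
      ∀ i, A (e i) = C (lam (e i)) * X (e i) + C (a i) * monomial (r • α) 1 * X (e i)
        + C (μ * β i) * monomial ((2 * r) • α) 1 * X (e i) := by
  choose h hHh hh using fun i => exists_eq_X_mul_subst_of_leading hα (hHα i) (hlam i) (hlead i)
  have hsum (b : ι → K) :
      ∑ i, α (e i) * (b i / lam (e i)) = ∑ i, b i * α (e i) / lam (e i) :=
    Finset.sum_congr rfl fun i _ => by ring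
  obtain ⟨p, μ, hp, hdef⟩ := exists_conjDefect_eq_zero (α := fun i => α (e i))
    (β := fun i => β i / lam (e i)) hr hh (by rwa [hsum]) (by rwa [hsum])
  have sH := hasSubst_of_mem_orderIdeal hH.mem_orderIdeal_one
  have hΨ := isTangentToId_monomialScaling he hα hp
  have hΨw := hasWeight_monomialScaling (p := p) he hα hlamα
  obtain ⟨A, hA, hconj⟩ := hΨ.exists_conj hH
  refine ⟨monomialScaling e α p, A, μ, hΨ, hconj, hA,
    fun j => hΨ.hasWeight_of_subst hΨw (hconj j ▸ (hΨw j).subst hHw sH),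
    fun i => hΨ.subst_injective ((hconj _).symm.trans ?_)⟩
  rw [prod_pow_eq_prod_comp he hαe] at hlamα
  rw [subst_monomialScaling_of_conjDefect_eq_zero he hα hαe hlamα sH hΨ.hasSubst hHh (hdef i)]
  congr 1
  have hC (b : K) : (C (lam (e i)) * C (b / lam (e i)) : MvPowerSeries σ K) = C b := by
    rw [← map_mul, mul_div_cancel₀ b (hlam i)]
  rw [monomial_pow, monomial_pow, one_pow, one_pow, ← hC (a i), ← hC (μ * β i), mul_div_assoc]
  ring

end NormalForm

section FormalMap

theorem mem_orderIdeal_two {σ R : Type*} [CommRing R] {f : MvPowerSeries σ R} :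
    f ∈ orderIdeal σ R 2 ↔ constantCoeff f = 0 ∧ ∀ i, coeff (Finsupp.single i 1) f = 0 := by
  refine ⟨fun h => ⟨mem_orderIdeal_one.1 (orderIdeal_anti one_le_two h),
    fun i => mem_orderIdeal.1 h _ (by simp)⟩, fun ⟨h₀, h₁⟩ => mem_orderIdeal.2 fun l hl => ?_⟩
  rcases Nat.le_one_iff_eq_zero_or_eq_one.1 (Nat.lt_succ_iff.1 hl) with hl | hl
  · rw [(Finsupp.degree_eq_zero_iff l).1 hl, coeff_zero_eq_constantCoeff_apply, h₀]
  · obtain ⟨i, rfl⟩ := (Finsupp.sum_eq_one_iff l).1 hl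
    exact h₁ i

variable {n : ℕ} {A B D : FormalMap n} {lam : Fin n → ℂ}

theorem coeff_single_C_mul_X {σ R : Type*} [CommRing R] [DecidableEq σ] (i j : σ) (c : R) :
    coeff (Finsupp.single i 1) (C c * X j) = if j = i then c else 0 := by
  rw [coeff_C_mul, coeff_X]
  simp [Finsupp.single_left_inj, eq_comm]

theorem hasDiagonalLinearPart_iff : HasDiagonalLinearPart lam A ↔
    (∀ j, constantCoeff (A j) = 0) ∧ A.linearPart = Matrix.diagonal lam := by
  simp only [HasDiagonalLinearPart, mem_orderIdeal_two, forall_and, map_sub, map_mul,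
    constantCoeff_X, mul_zero, sub_zero, coeff_single_C_mul_X, sub_eq_zero, ← Matrix.ext_iff,
    FormalMap.linearPart, Matrix.of_apply, Matrix.diagonal_apply]

theorem linearPart_comp (hB : ∀ j, constantCoeff (B j) = 0) :
    (A.comp B).linearPart = A.linearPart * B.linearPart := by
  classical
  have sB := hasSubst_of_constantCoeff_zero hB
  ext j i
  have hA : A j - (C (constantCoeff (A j)) + ∑ k, C (A.linearPart j k) * X k)
      ∈ orderIdeal (Fin n) ℂ 2 :=
    mem_orderIdeal_two.2 ⟨by simp, fun k => by
      simp only [map_sub, map_add, map_sum, coeff_single_C_mul_X]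
      simp [coeff_C, FormalMap.linearPart]⟩
  have h := (mem_orderIdeal_two.1
    (subst_mem_orderIdeal (fun j => mem_orderIdeal_one.2 (hB j)) hA)).2 i
  rw [← coe_substAlgHom sB] at h
  simp only [map_sub, map_add, map_sum, map_mul] at h
  simp only [coe_substAlgHom sB, subst_C, subst_X sB, coeff_C_mul] at h
  simpa [coeff_C, sub_eq_zero, Matrix.mul_apply, FormalMap.linearPart, FormalMap.comp] using h

theorem comp_assoc (hB : ∀ j, constantCoeff (B j) = 0) (hD : ∀ j, constantCoeff (D j) = 0) :
    (A.comp B).comp D = A.comp (B.comp D) :=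
  funext fun j => subst_comp_subst_apply (hasSubst_of_constantCoeff_zero hB)
    (hasSubst_of_constantCoeff_zero hD) (A j)

theorem FormallyConjugate.trans (hAB : FormallyConjugate A B) (hBD : FormallyConjugate B D)
    (hA : ∀ j, constantCoeff (A j) = 0) (hB : ∀ j, constantCoeff (B j) = 0) :
    FormallyConjugate A D := by
  obtain ⟨Φ, ⟨hΦ₀, hΦ₁⟩, hΦ⟩ := hAB
  obtain ⟨Ψ, ⟨hΨ₀, hΨ₁⟩, hΨ⟩ := hBD
  refine ⟨Ψ.comp Φ, ⟨fun j => constantCoeff_subst_eq_zero (hasSubst_of_constantCoeff_zero hΦ₀)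
    hΦ₀ (hΨ₀ j), linearPart_comp hΦ₀ ▸ hΨ₁.mul hΦ₁⟩, ?_⟩
  rw [comp_assoc hΦ₀ hA, hΦ, ← comp_assoc hB hΦ₀, hΨ, comp_assoc hΨ₀ hΦ₀]

theorem IsTangentToId.isFormalDiffeo {Ψ : FormalMap n} (hΨ : IsTangentToId Ψ) :
    Ψ.IsFormalDiffeo := by
  have h : HasDiagonalLinearPart 1 Ψ := fun j => by simpa using hΨ j
  obtain ⟨h₀, h₁⟩ := hasDiagonalLinearPart_iff.1 h
  refine ⟨h₀, ?_⟩
  rw [h₁]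
  simp

theorem hasOnlyResonantMonomials_of_hasWeight (hA : HasDiagonalLinearPart lam A) {j : Fin n}
    (hAw : HasWeight lam (lam j) (A j)) : HasOnlyResonantMonomials lam A j := by
  classical
  have h₁ := (hasDiagonalLinearPart_iff.1 hA).2
  refine ⟨by simpa [FormalMap.linearPart] using congrFun (congrFun h₁ j) j, fun l hl => ?_⟩
  by_cases hdeg : 2 ≤ l.degree
  · exact .inr ⟨hdeg, by rw [← hAw.prod_pow_eq hl, Finsupp.prod_fintype _ _ (by simp)]⟩
  · have h := mem_orderIdeal.1 (hA j) l (not_le.1 hdeg)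
    rw [map_sub, sub_eq_zero, coeff_C_mul, coeff_X] at h
    by_contra! hne
    exact hl (by rw [h, if_neg hne.1, mul_zero])

end FormalMap

section OneResonance

variable {n m : ℕ} {lam : Fin n → ℂ} {α : Fin n →₀ ℕ}

theorem IsDiffGerm.eigenvalue_ne_zero {F : (Fin n → ℂ) → (Fin n → ℂ)} (hF : IsDiffGerm F)
    (hdiag : HasDiagonalDifferential F lam) (j : Fin n) : lam j ≠ 0 := by
  obtain ⟨hFa, hF0, G, hGa, -, hGF, -⟩ := hF
  intro h_zero
  have hG : HasFDerivAt G (fderiv ℂ G 0) (F 0) :=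
    hF0.symm ▸ hGa.differentiableAt.hasFDerivAt
  have hcomp : (fderiv ℂ G 0).comp (fderiv ℂ F 0) = ContinuousLinearMap.id ℂ (Fin n → ℂ) :=
    (hG.comp 0 hFa.differentiableAt.hasFDerivAt).unique
      ((hasFDerivAt_id 0).congr_of_eventuallyEq hGF)
  have hker : fderiv ℂ F 0 (Pi.single j 1) = 0 := by
    ext i
    rw [hdiag]
    rcases eq_or_ne i j with rfl | hij
    · simp [h_zero]
    · simp [hij]
  simpa [hker] using congrFun (DFunLike.congr_fun hcomp (Pi.single j 1)) j

theorem constantCoeff_taylor (F : (Fin n → ℂ) → (Fin n → ℂ)) (j : Fin n) :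
    constantCoeff (taylor F j) = F 0 j := by
  have h_id : ∀ (L : List (Fin n)) (f : (Fin n → ℂ) → ℂ),
      L.foldr (fun i g => (partialDeriv i)^[(0 : Fin n →₀ ℕ) i] g) f = f := by
    intro L f
    induction L with
    | nil => rfl
    | cons i L ih => rw [List.foldr_cons, ih]; rfl
  change iteratedPartialDeriv 0 (fun z => F z j) 0 / ∏ i, (((0 : Fin n →₀ ℕ) i).factorial : ℂ) = _
  rw [iteratedPartialDeriv, h_id]
  simp

theorem IsOneResonant.exists_castLE_ne_zero (hres : IsOneResonant lam m α) (hmn : m ≤ n) :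
    ∃ j : Fin m, α (Fin.castLE hmn j) ≠ 0 := by
  obtain ⟨i, hi⟩ := Finsupp.ne_iff.1 hres.1
  exact ⟨⟨i, not_le.1 fun h => hi (hres.2.1 i h)⟩, hi⟩

theorem IsOneResonant.eq_zero_of_notMem_range_castLE (hres : IsOneResonant lam m α) (hmn : m ≤ n) :
    ∀ j ∉ Set.range (Fin.castLE hmn), α j = 0 :=
  fun j hj => hres.2.1 j (not_lt.1 fun h => hj ⟨⟨j, h⟩, rfl⟩)

theorem IsOneResonant.prod_pow_eq_one (hres : IsOneResonant lam m α) (hmn : m ≤ n)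
    (hlam : ∀ j, lam (Fin.castLE hmn j) ≠ 0) : (α.prod fun i l => lam i ^ l) = 1 := by
  obtain ⟨j, -⟩ := hres.exists_castLE_ne_zero hmn
  have h := ((hres.2.2 (Fin.castLE hmn j) j.2 _).2 ⟨1, le_rfl, rfl⟩).2
  rw [← Finsupp.prod_fintype _ (fun i l => lam i ^ l) (by simp),
    Finsupp.prod_add_index' (by simp) (fun i => pow_add (lam i)), one_smul] at h
  simpa [hlam j, eq_comm] using h

theorem HasOnlyResonantMonomials.exists_eq_smul_add_single {H : FormalMap n} {j : Fin n}
    (hH : HasOnlyResonantMonomials lam H j) (hres : IsOneResonant lam m α) (hj : (j : ℕ) < m)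
    {l : Fin n →₀ ℕ} (hl : coeff l (H j) ≠ 0) : ∃ s : ℕ, l = s • α + Finsupp.single j 1 := by
  rcases hH.2 l hl with rfl | hl
  · exact ⟨0, by simp⟩
  · obtain ⟨k, -, hk⟩ := (hres.2.2 j hj l).1 hl
    exact ⟨k, hk⟩

theorem IsOneResonant.sum_sq_div_normSq_ne_zero (hres : IsOneResonant lam m α) (hmn : m ≤ n)
    (hlam : ∀ j, lam (Fin.castLE hmn j) ≠ 0) :
    ∑ j : Fin m, ((α (Fin.castLE hmn j) : ℂ) * (conj (lam (Fin.castLE hmn j)))⁻¹)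
      * (α (Fin.castLE hmn j) : ℂ) / lam (Fin.castLE hmn j) ≠ 0 := by
  have h_term : ∀ j : Fin m,
      ((α (Fin.castLE hmn j) : ℂ) * (conj (lam (Fin.castLE hmn j)))⁻¹)
        * (α (Fin.castLE hmn j) : ℂ) / lam (Fin.castLE hmn j)
      = (((α (Fin.castLE hmn j) : ℝ) ^ 2 / Complex.normSq (lam (Fin.castLE hmn j)) : ℝ) : ℂ) := by
    intro j
    push_cast
    rw [Complex.normSq_eq_conj_mul_self]
    ring
  obtain ⟨i, hi⟩ := hres.exists_castLE_ne_zero hmn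
  simp_rw [h_term]
  rw [← Complex.ofReal_sum, Complex.ofReal_ne_zero]
  refine (Finset.sum_pos' (fun j _ => div_nonneg (sq_nonneg _) (Complex.normSq_nonneg _))
    ⟨i, Finset.mem_univ i, ?_⟩).ne'
  have := Complex.normSq_pos.2 (hlam i)
  positivity

variable {hmn : m ≤ n} {k : ℕ} {a : Fin m → ℂ} {G Ψ H : FormalMap n}

theorem HasLeadingForm.hasDiagonalLinearPart (hG : HasLeadingForm hmn lam α k a G) :
    HasDiagonalLinearPart lam G :=
  hasDiagonalLinearPart_iff.2 ⟨hG.1, hG.2.1⟩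

theorem HasLeadingForm.sub_mem_orderIdeal (hG : HasLeadingForm hmn lam α k a G) (j : Fin m) :
    G (Fin.castLE hmn j) - (C (lam (Fin.castLE hmn j)) * X (Fin.castLE hmn j)
      + C (a j) * monomial (k • α) 1 * X (Fin.castLE hmn j))
      ∈ orderIdeal (Fin n) ℂ (k * α.degree + 2) :=
  mem_orderIdeal.2 fun l hl => by rw [map_sub, hG.2.2 j l hl, sub_self]

theorem HasLeadingForm.of_poincareDulac (hG : HasLeadingForm hmn lam α k a G) (hα : α ≠ 0)
    (hk : 1 ≤ k) (hlamα : (α.prod fun i l => lam i ^ l) = 1) (hΨ : IsTangentToId Ψ)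
    (hH : HasDiagonalLinearPart lam H) (hconj : ∀ j, (Ψ j).subst G = (H j).subst Ψ)
    (hΨw : ∀ j, weightPart lam (lam j) (Ψ j - X j) = 0)
    (hHw : ∀ j, HasWeight lam (lam j) (H j)) : HasLeadingForm hmn lam α k a H := by
  obtain ⟨hH₀, hH₁⟩ := hasDiagonalLinearPart_iff.1 hH
  refine ⟨hH₀, hH₁, fun j l hl => ?_⟩
  have hdeg : 2 ≤ k * α.degree + 1 :=
    Nat.succ_le_succ (Nat.mul_pos hk (Nat.pos_of_ne_zero (mt (Finsupp.degree_eq_zero_iff α).1 hα)))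
  have h_order : C (a j) * monomial (k • α) 1 * X (Fin.castLE hmn j)
      ∈ orderIdeal (Fin n) ℂ (k * α.degree + 1) := by
    have h := monomial_mem_orderIdeal (k • α) (1 : ℂ)
    rw [map_nsmul, smul_eq_mul] at h
    exact mul_mem_orderIdeal (Ideal.mul_mem_left _ _ h) (X_mem_orderIdeal _)
  have h_weight : HasWeight lam (lam (Fin.castLE hmn j))
      (C (a j) * monomial (k • α) 1 * X (Fin.castLE hmn j)) := by
    have h := hasWeight_monomial (lam := lam) (k • α) (1 : ℂ)
    rw [Finsupp.prod_fintype _ _ (by simp)] at h hlamα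
    simpa [pow_mul', Finset.prod_pow, hlamα]
      using ((hasWeight_C (a j)).mul h).mul (hasWeight_X (Fin.castLE hmn j))
  have h := sub_mem_orderIdeal_of_poincareDulac hG.hasDiagonalLinearPart hΨ hH hconj hΨw hHw hdeg
    h_order h_weight (hG.sub_mem_orderIdeal j)
  rw [← sub_eq_zero, ← map_sub]
  exact mem_orderIdeal.1 h l hl

end OneResonance

end OneResonant

open OneResonant in
theorem theorem3p6_general {n m : ℕ} (hmn : m ≤ n) {B G : FormalMap n}
    {lam : Fin n → ℂ} {α : Fin n →₀ ℕ} {k : ℕ} {a β : Fin m → ℂ}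
    (hB : ∀ j, constantCoeff (B j) = 0)
    (hlam : ∀ j, lam (Fin.castLE hmn j) ≠ 0)
    (hres : IsOneResonant lam m α)
    (hBG : FormallyConjugate B G) (hk : 1 ≤ k)
    (hG : HasLeadingForm hmn lam α k a G)
    (hΛ : ∑ j, a j * (α (Fin.castLE hmn j) : ℂ) / lam (Fin.castLE hmn j) ≠ 0)
    (hβ : ∑ j, β j * (α (Fin.castLE hmn j) : ℂ) / lam (Fin.castLE hmn j) ≠ 0) :
    ∃ (μ : ℂ) (Fhat : FormalMap n),
      FormallyConjugate B Fhat ∧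
      (∀ j : Fin m, Fhat (Fin.castLE hmn j) =
        C (lam (Fin.castLE hmn j)) * X (Fin.castLE hmn j)
          + C (a j) * monomial (k • α) 1 * X (Fin.castLE hmn j)
          + C (μ * β j) * monomial ((2 * k) • α) 1 * X (Fin.castLE hmn j)) ∧
      ∀ j, HasOnlyResonantMonomials lam Fhat j := by
  have hα := hres.prod_pow_eq_one hmn hlam
  obtain ⟨Ψ, H, hΨ, hH, hGH, hΨw, hHw⟩ := exists_poincareDulac hG.hasDiagonalLinearPart
  have hHlead := hG.of_poincareDulac hres.1 hk hα hΨ hH hGH hΨw hHw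
  have hHα (i : Fin m) := hasOnlyResonantMonomials_of_hasWeight hH (hHw (Fin.castLE hmn i))
  obtain ⟨Φ, A, μ, hΦ, hHA, hA, hAw, hAe⟩ := exists_conj_of_hasWeight
    (Fin.castLE_injective hmn) hres.1 (hres.eq_zero_of_notMem_range_castLE hmn) hlam hα hH hHw
    (fun i _ => (hHα i).exists_eq_smul_add_single hres i.2) (Nat.one_le_iff_ne_zero.1 hk)
    hHlead.sub_mem_orderIdeal hΛ hβ
  have hGA : FormallyConjugate G A := FormallyConjugate.trans
    ⟨Ψ, hΨ.isFormalDiffeo, funext hGH⟩ ⟨Φ, hΦ.isFormalDiffeo, funext hHA⟩ hG.1 hHlead.1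
  exact ⟨μ, A, hBG.trans hGA hB hG.1, hAe,
    fun j => hasOnlyResonantMonomials_of_hasWeight hA (hAw j)⟩

theorem theorem3p6 {n m : ℕ} (hm : 1 ≤ m) (hmn : m ≤ n)
    (F : (Fin n → ℂ) → (Fin n → ℂ)) (lam : Fin n → ℂ) (α : Fin n →₀ ℕ)
    (hF : OneResonant.IsDiffGerm F)
    (hdiag : OneResonant.HasDiagonalDifferential F lam)
    (hres : OneResonant.IsOneResonant lam m α)
    (hnd : OneResonant.IsNonDegenerate hmn F lam α) :
    ∃ (k : ℕ) (μ : ℂ) (a : Fin m → ℂ) (Fhat : OneResonant.FormalMap n),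
      1 ≤ k ∧
      OneResonant.FormallyConjugate (OneResonant.taylor F) Fhat ∧
      (∀ j : Fin m, Fhat (Fin.castLE hmn j) =
        C (lam (Fin.castLE hmn j)) * X (Fin.castLE hmn j)
          + C (a j) * monomial (k • α) 1 * X (Fin.castLE hmn j)
          + C (μ * (α (Fin.castLE hmn j) : ℂ) * (conj (lam (Fin.castLE hmn j)))⁻¹)
              * monomial ((2 * k) • α) 1 * X (Fin.castLE hmn j)) ∧
      (∀ j : Fin n, m ≤ (j : ℕ) → OneResonant.HasOnlyResonantMonomials lam Fhat j) := by
  obtain ⟨G, k, a, hFG, hk, -, hG, hΛ⟩ := hnd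
  have hlam := fun j => hF.eigenvalue_ne_zero hdiag (Fin.castLE hmn j)
  obtain ⟨μ, Fhat, hconj, hcomp, hreson⟩ := theorem3p6_general hmn
    (fun j => by simp [OneResonant.constantCoeff_taylor, hF.2.1]) hlam hres hFG hk hG hΛ
    (hres.sum_sq_div_normSq_ne_zero hmn hlam)
  exact ⟨k, μ, a, Fhat, hk, hconj, fun j => by rw [hcomp, mul_assoc μ], fun j _ => hreson j⟩
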